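/- Let $\mathcal L=\{<,\sigma\}$ with $<$ a binary relation symbol and $\sigma$ a unary function symbol, and let $\mathrm{DLO}_\sigma$ be the $\mathcal L$-theory of (nonempty) dense linear orders without endpoints together with "$\sigma$ is an automorphism of the order". Call a point $x$ of a model constant (C), increasing (I) or decreasing (D) according to whether $\sigma(x)=x$, $x<\sigma(x)$ or $\sigma(x)<x$. Write $a\approx b$ if $a=b$, or if $a$, $b$ and all points between $a$ and $b$ have the same one of these three types; this is a first-order definable equivalence relation with convex classes, called blocks, and each block has a type C, I or D. A pattern consists of an integer $n\ge 1$ and a sequence $(p_1,\dots,p_n)$ with each $p_k\in\{C^1,C^\emptyset,I,D\}$, such that consecutive entries have different types (where $C^1$ and $C^\emptyset$ both have type C) and neither $p_1$ nor $p_n$ is $C^1$. Let $T_p$ be the $\mathcal L$-theory with the axioms: $\mathrm{DLO}_\sigma$; there are exactly $n$ $\approx$-classes; and, for each $k$, the $k$-th block from the left is of type C and a singleton if $p_k=C^1$, of type C and a dense linear order without endpoints if $p_k=C^\emptyset$, of type I if $p_k=I$, and of type D if $p_k=D$. Then: 1. For every pattern $p$ the theory $T_p$ is complete (in particular consistent),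 model complete and weakly o-minimal (in every model of $T_p$, every subset definable with parameters is a finite union of convex sets). 2. An $\mathcal L$-theory $T$ extending $\mathrm{DLO}_\sigma$ is complete and model complete if and only if it is logically equivalent to $T_p$ for some pattern $p$. 3. There are exactly $\aleph_0$ complete and model complete $\mathcal L$-theories (deductively closed sets of sentences) extending $\mathrm{DLO}_\sigma$. -/

import Mathlib

open FirstOrder FirstOrder.Language

universe w

/-! ### General notions for theories in a first-order language -/

namespace FirstOrder.Language.Theory

universe u v

variable {L : Language.{u, v}}

/-- A theory is model complete if every embedding between two of its models is elementary
(equivalently, if `M ⊆ N` are models, then `M ≼ N`). -/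
def IsModelComplete (T : L.Theory) : Prop :=
  ∀ (M N : Type w) [L.Structure M] [L.Structure N] [Nonempty M] [Nonempty N] [M ⊨ T] [N ⊨ T]
    (f : M ↪[L] N) (n : ℕ) (φ : L.Formula (Fin n)) (x : Fin n → M),
    φ.Realize (f ∘ x) ↔ φ.Realize x

/-- `T` extends `T₀`: every axiom of `T₀` is a consequence of `T`. -/
def Extends (T T₀ : L.Theory) : Prop := ∀ φ ∈ T₀, T ⊨ᵇ φ

/-- Two theories are logically equivalent if they have the same consequences. -/
def LogicallyEquivalent (T T' : L.Theory) : Prop := ∀ φ : L.Sentence, T ⊨ᵇ φ ↔ T' ⊨ᵇ φ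

/-- A theory is deductively closed if it contains all of its consequences. -/
def IsDeductivelyClosed (T : L.Theory) : Prop := ∀ φ : L.Sentence, T ⊨ᵇ φ → φ ∈ T

end FirstOrder.Language.Theory

namespace OrdAut

/-! ### The language with one binary relation symbol `<` and one unary function symbol `σ` -/

/-- The function symbols: a single unary symbol `σ`. -/
inductive Func : ℕ → Type
  | sigma : Func 1

/-- The relation symbols: a single binary symbol `<`. -/
inductive Rel : ℕ → Type
  | lt : Rel 2

/-- The language `{<, σ}`. -/
def lang : Language := ⟨Func, Rel⟩

/-- The symbol `σ`. -/
abbrev sigmaSymb : lang.Functions 1 := Func.sigma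

/-- The symbol `<`. -/
abbrev ltSymb : lang.Relations 2 := Rel.lt

/-- The interpretation of the symbol `<` in a structure. -/
def Lt {M : Type*} [lang.Structure M] (a b : M) : Prop :=
  Structure.RelMap ltSymb ![a, b]

/-! ### Basic formulas; the arguments are (names of) free variables -/

section Formulas

variable {α : Type}

/-- The term `x`. -/
def tm (x : α) : lang.Term α := Term.var x

/-- The term `σ(x)`. -/
def sg (x : α) : lang.Term α := sigmaSymb.apply₁ (tm x)

/-- The formula `s < t`, for terms `s` and `t`. -/
def ltT (s t : lang.Term α) : lang.Formula α := ltSymb.formula₂ s t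

/-- The formula `x < y`. -/
def lt (x y : α) : lang.Formula α := ltT (tm x) (tm y)

/-- The formula `x = y`. -/
def eq (x y : α) : lang.Formula α := Term.equal (tm x) (tm y)

/-- The formula `x ≤ y`. -/
def le (x y : α) : lang.Formula α := lt x y ⊔ eq x y

/-- The universal closure of a formula whose free variables are indexed by `Fin k`. -/
noncomputable def allS (k : ℕ) (φ : lang.Formula (Fin k)) : lang.Sentence :=
  (φ.relabel (Sum.inr : Fin k → Empty ⊕ Fin k)).iAlls (Fin k)

/-- `∃ z, φ z`. -/
noncomputable def ex1 (φ : lang.Formula (α ⊕ Fin 1)) : lang.Formula α := φ.iExs (Fin 1)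

/-- `∀ z, φ z`. -/
noncomputable def all1 (φ : lang.Formula (α ⊕ Fin 1)) : lang.Formula α := φ.iAlls (Fin 1)

end Formulas

/-! ### Dense linear orders without endpoints, with an automorphism -/

/-- The axioms of dense linear orders without endpoints, in the language `{<, σ}`. -/
noncomputable def dloAxioms : lang.Theory :=
  { allS 1 (∼(lt 0 0)),
    allS 3 (lt 0 1 ⟹ lt 1 2 ⟹ lt 0 2),
    allS 2 (lt 0 1 ⊔ eq 0 1 ⊔ lt 1 0),
    allS 2 (lt 0 1 ⟹ ex1 (lt (.inl 0) (.inr 0) ⊓ lt (.inr 0) (.inl 1))),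
    allS 1 (ex1 (lt (.inl 0) (.inr 0))),
    allS 1 (ex1 (lt (.inr 0) (.inl 0))) }

/-- The axioms saying that `σ` is an automorphism of the order: it is surjective, and it preserves
and reflects `<` (over linear orders it is then injective). -/
noncomputable def autAxioms : lang.Theory :=
  { allS 2 (lt 0 1 ⇔ ltT (sg 0) (sg 1)),
    allS 1 (ex1 (Term.equal (sg (.inr 0)) (tm (.inl 0)))) }

/-- The theory of dense linear orders without endpoints with an automorphism `σ`. -/
noncomputable def dloSigma : lang.Theory := dloAxioms ∪ autAxioms

/-! ### The equivalence relation `≈` and its classes, the blocks -/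

section Blocks

variable {α : Type}

/-- The three types of a point or of a block: constant, increasing, decreasing. -/
inductive BlockType
  | const
  | inc
  | dec
  deriving DecidableEq

/-- `x` is of the given type: `σ(x) = x`, `x < σ(x)` or `σ(x) < x`, respectively. -/
def hasType : BlockType → α → lang.Formula α
  | .const, x => Term.equal (sg x) (tm x)
  | .inc, x => ltT (tm x) (sg x)
  | .dec, x => ltT (sg x) (tm x)

/-- `a`, `e` and `b` agree on the property of being of type `t`. -/
def agree (t : BlockType) (a e b : α) : lang.Formula α :=
  (hasType t a ⇔ hasType t e) ⊓ (hasType t e ⇔ hasType t b)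

/-- `R(a, b)`: `a < b`, and `a`, `b` and all points between them are of the same type. -/
noncomputable def relR (a b : α) : lang.Formula α :=
  lt a b ⊓ all1 ((lt (.inl a) (.inr 0) ⊓ lt (.inr 0) (.inl b)) ⟹
    (agree .const (.inl a) (.inr 0) (.inl b) ⊓ agree .inc (.inl a) (.inr 0) (.inl b) ⊓
      agree .dec (.inl a) (.inr 0) (.inl b)))

/-- `a ≈ b`: the reflexive and symmetric closure of `R`. -/
noncomputable def approx (a b : α) : lang.Formula α := eq a b ⊔ relR a b ⊔ relR b a

/-- `y₀ < y₁ < ⋯ < yₖ₋₁`, and these elements are pairwise not `≈`-equivalent. -/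
noncomputable def chain (k : ℕ) (y : Fin k → α) : lang.Formula α :=
  Formula.iInf fun p : {p : Fin k × Fin k // p.1 < p.2} =>
    lt (y p.1.1) (y p.1.2) ⊓ ∼(approx (y p.1.1) (y p.1.2))

/-- At least `k` of the `≈`-classes meet the set of all `y ≤ x`. -/
noncomputable def atLeastUpTo (k : ℕ) (x : α) : lang.Formula α :=
  Formula.iExs (Fin k) (chain k (fun i => (Sum.inr i : α ⊕ Fin k)) ⊓
    Formula.iInf fun i : Fin k => le (Sum.inr i : α ⊕ Fin k) (.inl x))

/-- `x` is in the `k`-th block, the blocks being numbered `1, 2, …` from left to right: exactly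
`k` of the `≈`-classes meet the set of all `y ≤ x`. -/
noncomputable def inBlock (k : ℕ) (x : α) : lang.Formula α :=
  atLeastUpTo k x ⊓ ∼(atLeastUpTo (k + 1) x)

/-- There are at least `k` of the `≈`-classes. -/
noncomputable def atLeastClasses (k : ℕ) : lang.Sentence :=
  Formula.iExs (Fin k) (chain k (fun i => (Sum.inr i : Empty ⊕ Fin k)))

/-- There are exactly `n` of the `≈`-classes. -/
noncomputable def exactlyClasses (n : ℕ) : lang.Sentence :=
  atLeastClasses n ⊓ ∼(atLeastClasses (n + 1))

end Blocks

/-! ### The theories given by a pattern of blocks -/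

/-- What is specified about a block: constant and a singleton (`C¹`), constant and a dense linear
order without endpoints (`C^∅`), increasing, or decreasing. -/
inductive BlockKind
  | constSingleton
  | constDLO
  | inc
  | dec
  deriving DecidableEq

/-- The type (constant, increasing, decreasing) of a kind of block. -/
def BlockKind.type : BlockKind → BlockType
  | .constSingleton => .const
  | .constDLO => .const
  | .inc => .inc
  | .dec => .dec

/-- All points of the `k`-th block are of type `t`. -/
noncomputable def blockHasType (k : ℕ) (t : BlockType) : lang.Sentence :=
  allS 1 (inBlock k 0 ⟹ hasType t 0)

/-- The `k`-th block has at most one element. -/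
noncomputable def blockSubsingleton (k : ℕ) : lang.Sentence :=
  allS 2 (inBlock k 0 ⟹ inBlock k 1 ⟹ eq 0 1)

/-- The `k`-th block is densely ordered. -/
noncomputable def blockDense (k : ℕ) : lang.Sentence :=
  allS 2 (inBlock k 0 ⟹ inBlock k 1 ⟹ lt 0 1 ⟹
    ex1 (inBlock k (.inr 0) ⊓ lt (.inl 0) (.inr 0) ⊓ lt (.inr 0) (.inl 1)))

/-- The `k`-th block has no greatest element. -/
noncomputable def blockNoMax (k : ℕ) : lang.Sentence :=
  allS 1 (inBlock k 0 ⟹ ex1 (inBlock k (.inr 0) ⊓ lt (.inl 0) (.inr 0)))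

/-- The `k`-th block has no least element. -/
noncomputable def blockNoMin (k : ℕ) : lang.Sentence :=
  allS 1 (inBlock k 0 ⟹ ex1 (inBlock k (.inr 0) ⊓ lt (.inr 0) (.inl 0)))

/-- The axioms saying that the `k`-th block is of the given kind. -/
noncomputable def blockAxioms (k : ℕ) : BlockKind → lang.Theory
  | .constSingleton => {blockHasType k .const, blockSubsingleton k}
  | .constDLO => {blockHasType k .const, blockDense k, blockNoMax k, blockNoMin k}
  | .inc => {blockHasType k .inc}
  | .dec => {blockHasType k .dec}

/-- The theory given by a pattern `p` of `n` blocks: dense linear orders without endpoints with an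
automorphism, exactly `n` of the `≈`-classes, and the blocks are, from left to right, of the kinds
`p 0, p 1, …`. -/
noncomputable def blockTheory {n : ℕ} (p : Fin n → BlockKind) : lang.Theory :=
  dloSigma ∪ {exactlyClasses n} ∪ ⋃ i : Fin n, blockAxioms ((i : ℕ) + 1) (p i)

/-- The patterns that can occur: there is at least one block, the types of consecutive blocks
differ (two neighbouring blocks of the same type would be a single `≈`-class), and neither the
first nor the last block is a singleton (there are no endpoints). -/
structure IsAlternationPattern {n : ℕ} (p : Fin n → BlockKind) : Prop where
  pos : 0 < n
  alternates : ∀ i j : Fin n, (i : ℕ) + 1 = j → (p i).type ≠ (p j).type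
  interior : ∀ i : Fin n, p i = .constSingleton → 0 < (i : ℕ) ∧ (i : ℕ) + 1 < n

/-! ### Weak o-minimality -/

/-- A convex subset of a structure. -/
def IsConvex {M : Type w} [lang.Structure M] (C : Set M) : Prop :=
  ∀ a ∈ C, ∀ b ∈ C, ∀ c : M, Lt a c → Lt c b → c ∈ C

/-- A theory is weakly o-minimal if, in each of its models, `<` is a linear order and every subset
of the universe that is definable with parameters is a finite union of convex sets. -/
def IsWeaklyOMinimal (T : lang.Theory) : Prop :=
  ∀ (M : Type w) [lang.Structure M] [Nonempty M] [M ⊨ T],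
    IsStrictTotalOrder M Lt ∧
    ∀ S : Set M, (Set.univ : Set M).Definable₁ lang S →
      ∃ F : Set (Set M), F.Finite ∧ (∀ C ∈ F, IsConvex C) ∧ S = ⋃₀ F

end OrdAut

/-! A term of the language is an iterate `σ^m` of a variable, and in a model of `T_p` every
non-singleton block is a dense order without endpoints: constant ones by axiom, increasing and
decreasing ones because `σ` or `σ⁻¹` moves every point in either direction inside its block. Call
two tuples similar up to `K` (`Sim`) if their entries lie in blocks with the same numbers and the
relations `σ^m(x_i) < x_j`, `|m| ≤ K`, agree. Given similarity up to `2K`, a new point can be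
answered by a point of the same block in the same cut over the `σ^m(x_i)`, `|m| ≤ K`; how it
compares with its own iterates depends only on the type of its block. Hence similarity up to `K`
survives (`Sim.exists_snoc`), and each formula is invariant under similarity up to a `K` depending
only on the formula and the pattern (`exists_sim_realize_iff`).

This one statement gives the first claim. Sentences involve no points, so with a lexicographic sum
of copies of `ℚ` and single points as a model, `T_p` is complete. An embedding preserves the numbers
of the blocks because types alternate (`IsBlockMap.index_map`), so it preserves similarity, hence
formulas. A set definable with parameters is determined by the block of a point and its cut over
finitely many iterates of parameters, and these conditions have convex fibres.

Conversely, let `T` be model complete. If a model had infinitely many blocks, pigeonhole and an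
ultrapower would give a model with points `a < b` of the same complete type in distinct blocks, and
some `y ≈ a` above the whole orbit of `a`. Take elementary embeddings `i`, `g` into one structure
with `g a = i b`; following `i` below the orbit of `a` and `g` above it is an embedding that
separates `a` from `y` although `≈` is definable (`exists_embedding_not_approx`). So there are
finitely many blocks. In a countable model a constant block with more than one point embeds into any
of its own intervals; extended by the identity this is a self-embedding, so no point of the block is
an endpoint (`realize_of_mem_Ioo`). A countable model of `T` therefore satisfies some `T_p`, and
completeness makes the two theories equivalent. Patterns are countably many, and alternating
increasing and decreasing blocks give infinitely many inequivalent theories. -/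

namespace OrdAut

/-! ### Structures that are dense linear orders without endpoints, with an automorphism -/

/-- A dense linear order without endpoints with an automorphism, as a structure for `lang`. -/
class AutOrder (M : Type*) [lang.Structure M] extends LinearOrder M where
  dense : DenselyOrdered M
  noMin : NoMinOrder M
  noMax : NoMaxOrder M
  sigma : M ≃o M
  lt_iff : ∀ a b : M, Lt a b ↔ a < b
  funMap_sigma : ∀ x : Fin 1 → M, Structure.funMap sigmaSymb x = sigma (x 0)

/-! ### Semantics of the basic formulas and axioms -/

section Realize

variable {M : Type*} [lang.Structure M] {α : Type}

theorem realize_allS {k : ℕ} {φ : lang.Formula (Fin k)} :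
    M ⊨ allS k φ ↔ ∀ v : Fin k → M, φ.Realize v := by
  rw [Sentence.Realize, allS, Formula.realize_iAlls]
  refine forall_congr' fun v => ?_
  rw [Formula.realize_relabel]
  rfl

theorem realize_ex1 {φ : lang.Formula (α ⊕ Fin 1)} {v : α → M} :
    (ex1 φ).Realize v ↔ ∃ z : M, φ.Realize (Sum.elim v fun _ => z) := by
  rw [ex1, Formula.realize_iExs]
  exact ⟨fun ⟨i, h⟩ => ⟨i 0, by convert h using 3 with j; rw [Subsingleton.elim j 0]⟩,
    fun ⟨z, h⟩ => ⟨_, h⟩⟩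

theorem realize_all1 {φ : lang.Formula (α ⊕ Fin 1)} {v : α → M} :
    (all1 φ).Realize v ↔ ∀ z : M, φ.Realize (Sum.elim v fun _ => z) := by
  rw [all1, Formula.realize_iAlls]
  exact ⟨fun h z => h _, fun h i => by convert h (i 0) using 3 with j; rw [Subsingleton.elim j 0]⟩

theorem realize_ltT {s t : lang.Term α} {v : α → M} :
    (ltT s t).Realize v ↔ Lt (s.realize v) (t.realize v) :=
  Formula.realize_rel₂

theorem realize_lt {x y : α} {v : α → M} : (lt x y).Realize v ↔ Lt (v x) (v y) :=
  realize_ltT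

theorem realize_eq {x y : α} {v : α → M} : (eq x y).Realize v ↔ v x = v y :=
  Formula.realize_equal

theorem realize_sg {x : α} {v : α → M} :
    (sg x).realize v = Structure.funMap sigmaSymb ![v x] :=
  Term.realize_functions_apply₁

theorem models_dloSigma_iff : M ⊨ dloSigma ↔
    (∀ a : M, ¬ Lt a a) ∧ (∀ a b c : M, Lt a b → Lt b c → Lt a c) ∧
    (∀ a b : M, (Lt a b ∨ a = b) ∨ Lt b a) ∧ (∀ a b : M, Lt a b → ∃ z, Lt a z ∧ Lt z b) ∧
    (∀ a : M, ∃ z, Lt a z) ∧ (∀ a : M, ∃ z, Lt z a) ∧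
    (∀ a b : M, Lt a b ↔
      Lt (Structure.funMap sigmaSymb ![a]) (Structure.funMap sigmaSymb ![b])) ∧
    (∀ a : M, ∃ z : M, Structure.funMap sigmaSymb ![z] = a) := by
  simp only [dloSigma, dloAxioms, autAxioms, Theory.model_iff, Set.mem_union, Set.mem_insert_iff,
    Set.mem_singleton_iff, or_imp, forall_and, forall_eq, realize_allS, Formula.realize_not,
    Formula.realize_imp, Formula.realize_sup, Formula.realize_iff, Formula.realize_inf, realize_ex1,
    realize_lt, realize_eq, realize_ltT, realize_sg, Formula.realize_equal, Sum.elim_inl,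
    Sum.elim_inr, Fin.forall_fin_succ_pi, Fin.forall_fin_zero_pi, and_assoc]
  rfl

end Realize

theorem nonempty_autOrder (M : Type*) [lang.Structure M] [M ⊨ dloSigma] :
    Nonempty (AutOrder M) := by
  classical
  obtain ⟨hirr, htr, htri, hd, hmax, hmin, hs, hsurj⟩ :=
    models_dloSigma_iff.1 (inferInstance : M ⊨ dloSigma)
  have : IsStrictTotalOrder M Lt :=
    { irrefl := hirr
      trans := htr
      trichotomous := fun a b h h' => ((htri a b).resolve_right h').resolve_left h }
  let L : LinearOrder M := linearOrderOfSTO Lt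
  have key : ∀ a b : M, a < b ↔
      Structure.funMap sigmaSymb ![a] < Structure.funMap sigmaSymb ![b] := hs
  let s : M → M := fun a => Structure.funMap sigmaSymb ![a]
  have mono : StrictMono s := fun a b h => (key a b).1 h
  exact ⟨{ L with
    dense := ⟨hd⟩
    noMin := ⟨hmin⟩
    noMax := ⟨hmax⟩
    sigma := mono.orderIsoOfSurjective s hsurj
    lt_iff := fun _ _ => Iff.rfl
    funMap_sigma := fun x => by
      change _ = Structure.funMap sigmaSymb ![x 0]
      congr
      exact List.ofFn_inj.mp rfl }⟩

/-! ### Types of points, the relation `≈`, and chains of inequivalent points -/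

namespace AutOrder

variable {M : Type*} [lang.Structure M] [AutOrder M] {α : Type}

instance : DenselyOrdered M := AutOrder.dense
instance : NoMinOrder M := AutOrder.noMin
instance : NoMaxOrder M := AutOrder.noMax

variable (M) in
theorem models_dloSigma : M ⊨ dloSigma := by
  simp only [models_dloSigma_iff, lt_iff, funMap_sigma]
  exact ⟨lt_irrefl, fun _ _ _ => lt_trans, fun a b => by
    rcases lt_trichotomy a b with h | h | h <;> simp [h],
    fun _ _ => exists_between, exists_gt, exists_lt, fun a b => by simp, fun a =>
    ⟨sigma.symm a, by simp⟩⟩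

open Classical in
/-- The type of a point. -/
noncomputable def typ (x : M) : BlockType :=
  if sigma x = x then .const else if x < sigma x then .inc else .dec

theorem typ_eq_const {x : M} : typ x = .const ↔ sigma x = x := by
  rw [typ]; split_ifs <;> simp_all

theorem typ_eq_inc {x : M} : typ x = .inc ↔ x < sigma x := by
  rw [typ]; split_ifs with h h' <;> simp [*]

theorem typ_eq_dec {x : M} : typ x = .dec ↔ sigma x < x := by
  rw [typ]; split_ifs with h h'
  · simp [h]
  · simp [h'.le]
  · simpa using lt_of_le_of_ne (not_lt.1 h') h

theorem realize_hasType {t : BlockType} {x : α} {v : α → M} :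
    (hasType t x).Realize v ↔ typ (v x) = t := by
  cases t
  · simp only [hasType, Formula.realize_equal, realize_sg, funMap_sigma, typ_eq_const]; rfl
  · simp only [hasType, realize_ltT, realize_sg, funMap_sigma, typ_eq_inc, lt_iff]; rfl
  · simp only [hasType, realize_ltT, realize_sg, funMap_sigma, typ_eq_dec, lt_iff]; rfl

/-- The relation `≈`. -/
def Approx (a b : M) : Prop := ∀ e ∈ Set.uIcc a b, typ e = typ a

theorem Approx.refl (a : M) : Approx a a := by simp [Approx]

theorem Approx.typ_eq {a b : M} (h : Approx a b) : typ b = typ a := h b Set.right_mem_uIcc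

theorem Approx.symm {a b : M} (h : Approx a b) : Approx b a := fun e he =>
  (h e (Set.uIcc_comm b a ▸ he)).trans h.typ_eq.symm

theorem Approx.trans {a b c : M} (h : Approx a b) (h' : Approx b c) : Approx a c := fun e he => by
  rcases Set.uIcc_subset_uIcc_union_uIcc he with he | he
  · exact h e he
  · exact (h' e he).trans h.typ_eq

theorem Approx.of_mem {a b c : M} (h : Approx a b) (hc : c ∈ Set.uIcc a b) : Approx a c :=
  fun e he => h e (Set.uIcc_subset_uIcc_left hc he)

theorem Approx.left_of_le_of_le {a b c : M} (h : Approx a b) (h1 : a ≤ c) (h2 : c ≤ b) :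
    Approx a c :=
  h.of_mem (Set.mem_uIcc_of_le h1 h2)

theorem Approx.right_of_le_of_le {a b c : M} (h : Approx a b) (h1 : a ≤ c) (h2 : c ≤ b) :
    Approx c b :=
  (h.left_of_le_of_le h1 h2).symm.trans h

/-- Classes are convex, so the order between two distinct classes does not depend on
representatives. -/
theorem lt_of_approx {a a' b b' : M} (hab : a < b) (h : ¬ Approx a b) (ha : Approx a a')
    (hb : Approx b b') : a' < b' := by
  have h1 : a' < b := by
    by_contra! h1
    exact h (ha.left_of_le_of_le hab.le h1)
  by_contra! h2
  exact h (ha.trans ((hb.symm.left_of_le_of_le h2 h1.le).symm.trans hb.symm))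

theorem agree_iff (A B C : BlockType) :
    (((A = .const ↔ B = .const) ∧ (B = .const ↔ C = .const)) ∧
      ((A = .inc ↔ B = .inc) ∧ (B = .inc ↔ C = .inc))) ∧
      ((A = .dec ↔ B = .dec) ∧ (B = .dec ↔ C = .dec)) ↔ A = B ∧ B = C := by
  cases A <;> cases B <;> cases C <;> simp

theorem realize_relR {a b : α} {v : α → M} :
    (relR a b).Realize v ↔ v a < v b ∧ Approx (v a) (v b) := by
  simp only [relR, Formula.realize_inf, realize_lt, realize_all1, Formula.realize_imp, agree,
    Formula.realize_iff, realize_hasType, lt_iff, Sum.elim_inl, Sum.elim_inr]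
  refine and_congr_right fun hab => ⟨fun h => ?_, fun h z hz => ?_⟩
  · have h' : ∀ z, v a < z ∧ z < v b → typ (v a) = typ z ∧ typ z = typ (v b) := by
      exact fun z hz => (agree_iff _ _ _).1 (h z hz)
    -- The formula constrains only points strictly between; density provides one, through which the
    -- types of the two ends are compared.
    obtain ⟨z, hz⟩ := exists_between hab
    intro e he
    rw [Set.uIcc_of_le hab.le] at he
    rcases he.1.eq_or_lt with h1 | h1
    · rw [← h1]
    rcases he.2.eq_or_lt with h2 | h2
    · rw [h2, (h' z hz).1, (h' z hz).2]
    · exact (h' e ⟨h1, h2⟩).1.symm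
  · exact (agree_iff _ _ _).2 ⟨(h z (Set.mem_uIcc_of_le hz.1.le hz.2.le)).symm,
      (h z (Set.mem_uIcc_of_le hz.1.le hz.2.le)).trans h.typ_eq.symm⟩

theorem realize_approx {a b : α} {v : α → M} :
    (approx a b).Realize v ↔ Approx (v a) (v b) := by
  simp only [approx, Formula.realize_sup, realize_eq, realize_relR]
  constructor
  · rintro ((h | h) | h)
    · rw [h]; exact .refl _
    · exact h.2
    · exact h.2.symm
  · intro h
    rcases lt_trichotomy (v a) (v b) with h1 | h1 | h1
    · exact .inl (.inr ⟨h1, h⟩)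
    · exact .inl (.inl h1)
    · exact .inr ⟨h1, h.symm⟩

/-- An increasing sequence of points of distinct blocks. -/
def IsChain {k : ℕ} (y : Fin k → M) : Prop := ∀ i j, i < j → y i < y j ∧ ¬ Approx (y i) (y j)

theorem realize_chain {k : ℕ} {y : Fin k → α} {v : α → M} :
    (chain k y).Realize v ↔ IsChain (v ∘ y) := by
  simp only [chain, Formula.realize_iInf, Formula.realize_inf, Formula.realize_not, realize_lt,
    realize_approx, lt_iff, IsChain, Subtype.forall, Prod.forall, Function.comp]

theorem realize_atLeastClasses {k : ℕ} :
    M ⊨ atLeastClasses k ↔ ∃ y : Fin k → M, IsChain y := by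
  rw [Sentence.Realize, atLeastClasses, Formula.realize_iExs]
  exact exists_congr fun y => realize_chain

theorem realize_exactlyClasses {k : ℕ} :
    M ⊨ exactlyClasses k ↔
      (∃ y : Fin k → M, IsChain y) ∧ ¬ ∃ y : Fin (k + 1) → M, IsChain y := by
  rw [← realize_atLeastClasses, ← realize_atLeastClasses]
  exact (Formula.realize_inf).trans (and_congr_right fun _ => Formula.realize_not)

/-- At least `k` blocks meet the set of points `≤ x`. -/
def AtLeastUpTo (k : ℕ) (x : M) : Prop := ∃ y : Fin k → M, IsChain y ∧ ∀ i, y i ≤ x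

theorem realize_atLeastUpTo {k : ℕ} {x : α} {v : α → M} :
    (atLeastUpTo k x).Realize v ↔ AtLeastUpTo k (v x) := by
  simp only [atLeastUpTo, Formula.realize_iExs, Formula.realize_inf, realize_chain,
    Formula.realize_iInf, le, Formula.realize_sup, realize_lt, realize_eq, lt_iff, AtLeastUpTo,
    Sum.elim_inl, Sum.elim_inr, ← le_iff_lt_or_eq]
  rfl

theorem realize_inBlock {k : ℕ} {x : α} {v : α → M} :
    (inBlock k x).Realize v ↔ AtLeastUpTo k (v x) ∧ ¬ AtLeastUpTo (k + 1) (v x) := by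
  simp only [inBlock, Formula.realize_inf, Formula.realize_not, realize_atLeastUpTo]

variable {M : Type*} [lang.Structure M] [AutOrder M] {n : ℕ}

/-! ### Numbering the blocks -/

/-- `β` numbers the blocks from left to right. -/
structure IsBlockIndex (β : M → Fin n) : Prop where
  mono : Monotone β
  surj : Function.Surjective β
  eq_iff : ∀ {a b : M}, β a = β b ↔ Approx a b

namespace IsBlockIndex

variable {β : M → Fin n}

theorem isChain_iff (h : IsBlockIndex β) {k : ℕ} {y : Fin k → M} :
    IsChain y ↔ StrictMono (β ∘ y) :=
  ⟨fun hy i j hij => lt_of_le_of_ne (h.mono (hy i j hij).1.le) (mt h.eq_iff.1 (hy i j hij).2),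
    fun hy _ _ hij => ⟨h.mono.reflect_lt (hy hij), mt h.eq_iff.2 (hy hij).ne⟩⟩

theorem exists_isChain_iff (h : IsBlockIndex β) {k : ℕ} :
    (∃ y : Fin k → M, IsChain y) ↔ k ≤ n := by
  simp only [h.isChain_iff]
  constructor
  · rintro ⟨y, hy⟩
    simpa using Fintype.card_le_of_injective _ hy.injective
  · intro hk
    obtain ⟨g, hg⟩ := h.surj.hasRightInverse
    exact ⟨fun i => g (i.castLE hk), fun _ _ hij => by simpa [hg _] using hij⟩

theorem atLeastUpTo_iff (h : IsBlockIndex β) {k : ℕ} {x : M} :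
    AtLeastUpTo k x ↔ k ≤ β x + 1 := by
  simp only [AtLeastUpTo, h.isChain_iff]
  constructor
  · rintro ⟨y, hy, hx⟩
    have : Function.Injective fun i => (⟨β (y i), Finset.mem_Iic.2 (h.mono (hx i))⟩ :
        Finset.Iic (β x)) := fun i j hij => hy.injective (congrArg Subtype.val hij)
    have := Fintype.card_le_of_injective _ this
    rwa [Fintype.card_fin, Fintype.card_coe, Fin.card_Iic] at this
  · intro hk
    obtain ⟨g, hg⟩ := h.surj.hasRightInverse
    -- The chosen representative of the block of `x` may lie above `x`; taking the minimum with `x`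
    -- corrects this without leaving the block.
    refine ⟨fun i => min (g ⟨i, by omega⟩) x, fun i j hij => ?_, fun i => min_le_right _ _⟩
    have key : ∀ i : Fin k, ((β (min (g ⟨i, by omega⟩) x) : Fin n) : ℕ) = i := by
      intro i
      rw [h.mono.map_min, hg, min_eq_left]
      rw [Fin.le_def]
      simp only
      omega
    rw [Fin.lt_def]
    simpa only [Function.comp, key] using Fin.lt_def.1 hij

theorem realize_inBlock (h : IsBlockIndex β) {α : Type} {i : Fin n} {x : α} {v : α → M} :
    (inBlock (i + 1) x).Realize v ↔ β (v x) = i := by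
  rw [AutOrder.realize_inBlock, h.atLeastUpTo_iff, h.atLeastUpTo_iff, Fin.ext_iff]
  omega

theorem realize_exactlyClasses (h : IsBlockIndex β) : M ⊨ exactlyClasses n := by
  rw [AutOrder.realize_exactlyClasses, h.exists_isChain_iff, h.exists_isChain_iff]
  omega

end IsBlockIndex

theorem IsChain.comp {k l : ℕ} {y : Fin k → M} (hy : IsChain y) {g : Fin l → Fin k}
    (hg : StrictMono g) : IsChain (y ∘ g) :=
  fun _ _ hij => hy _ _ (hg hij)

theorem AtLeastUpTo.anti {k l : ℕ} {x : M} (h : AtLeastUpTo k x) (hl : l ≤ k) :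
    AtLeastUpTo l x := by
  obtain ⟨y, hy, hx⟩ := h
  exact ⟨_, hy.comp (Fin.strictMono_castLE hl), fun i => hx _⟩

theorem AtLeastUpTo.mono {k : ℕ} {x x' : M} (h : AtLeastUpTo k x) (hx : x ≤ x') :
    AtLeastUpTo k x' := by
  obtain ⟨y, hy, hy'⟩ := h
  exact ⟨y, hy, fun i => (hy' i).trans hx⟩

/-- A chain below `b` is truncated at `a`: a member between `a` and `b` is equivalent to `a`, so
only the last one can be moved, and it stays in its class. -/
theorem AtLeastUpTo.of_approx {k : ℕ} {a b : M} (h : AtLeastUpTo k b) (hab : Approx a b) :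
    AtLeastUpTo k a := by
  rcases le_total b a with hle | hle
  · exact h.mono hle
  obtain ⟨y, hy, hx⟩ := h
  refine ⟨fun i => min (y i) a, fun i j hij => ?_, fun i => min_le_right _ _⟩
  obtain ⟨h1, h2⟩ := hy i j hij
  rcases le_or_gt (y j) a with hj | hj
  · simpa only [min_eq_left hj, min_eq_left (h1.le.trans hj)] using ⟨h1, h2⟩
  · have h3 : Approx (y j) a := (hab.left_of_le_of_le hj.le (hx j)).symm
    have h4 := lt_of_approx h1 h2 (.refl _) h3
    simp only [min_eq_right hj.le, min_eq_left h4.le]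
    exact ⟨h4, fun h5 => h2 (h5.trans h3.symm)⟩

theorem AtLeastUpTo.succ {k : ℕ} {a b : M} (h : AtLeastUpTo k a) (hab : a < b)
    (hn : ¬ Approx a b) : AtLeastUpTo (k + 1) b := by
  obtain ⟨y, hy, hx⟩ := h
  refine ⟨Fin.snoc y b, fun i j hij => ?_, fun i => ?_⟩
  · induction i using Fin.lastCases with
    | last => exact absurd hij (Fin.le_last j).not_gt
    | cast i =>
      induction j using Fin.lastCases with
      | last =>
        rw [Fin.snoc_castSucc, Fin.snoc_last]
        exact ⟨(hx i).trans_lt hab, fun h => hn (h.right_of_le_of_le (hx i) hab.le)⟩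
      | cast j =>
        rw [Fin.snoc_castSucc, Fin.snoc_castSucc]
        exact hy i j (Fin.castSucc_lt_castSucc_iff.1 hij)
  · induction i using Fin.lastCases with
    | last => simp
    | cast i => simpa using (hx i).trans hab.le

theorem atLeastUpTo_one (x : M) : AtLeastUpTo 1 x :=
  ⟨fun _ => x, fun i j hij => absurd hij (by simp [Subsingleton.elim i j]), fun _ => le_rfl⟩

-- A point is numbered by the count of classes meeting the points up to it, less one. The count is
-- constant on classes and grows strictly between them, so a chain of length `n` takes all `n`
-- values.
open Classical in
theorem exists_isBlockIndex (h1 : ∃ y : Fin n → M, IsChain y)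
    (h2 : ¬ ∃ y : Fin (n + 1) → M, IsChain y) : ∃ β : M → Fin n, IsBlockIndex β := by
  have bound : ∀ {k} {x : M}, AtLeastUpTo k x → k ≤ n := by
    intro k x hk
    by_contra! hn
    obtain ⟨y, hy, -⟩ := hk.anti hn
    exact h2 ⟨y, hy⟩
  let cnt : M → ℕ := fun x => Nat.findGreatest (AtLeastUpTo · x) n
  have cnt_iff : ∀ k x, AtLeastUpTo k x ↔ k ≤ cnt x := fun k x =>
    ⟨fun h => Nat.le_findGreatest (bound h) h, fun h =>
      AtLeastUpTo.anti (Nat.findGreatest_spec (P := (AtLeastUpTo · x)) (bound (atLeastUpTo_one x))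
        (atLeastUpTo_one x)) h⟩
  have pos : ∀ x, 1 ≤ cnt x := fun x => (cnt_iff 1 x).1 (atLeastUpTo_one x)
  have le : ∀ x, cnt x ≤ n := fun x => bound ((cnt_iff _ x).2 le_rfl)
  have mono : Monotone cnt := fun a b hab => (cnt_iff _ b).1 (((cnt_iff _ a).2 le_rfl).mono hab)
  have strict : ∀ a b, a < b → ¬ Approx a b → cnt a < cnt b := fun a b hab hn =>
    (cnt_iff _ b).1 (((cnt_iff _ a).2 le_rfl).succ hab hn)
  have congr : ∀ a b, Approx a b → cnt a = cnt b := fun a b hab => le_antisymm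
    ((cnt_iff _ b).1 (((cnt_iff _ a).2 le_rfl).of_approx hab.symm))
    ((cnt_iff _ a).1 (((cnt_iff _ b).2 le_rfl).of_approx hab))
  refine ⟨fun x => ⟨cnt x - 1, by have := pos x; have := le x; omega⟩, fun a b hab => ?_, ?_,
    fun {a b} => ⟨fun h => ?_, fun h => ?_⟩⟩
  · have := mono hab
    simp only [Fin.mk_le_mk]
    omega
  · obtain ⟨y, hy⟩ := h1
    refine Function.Surjective.of_comp (g := y) (Finite.surjective_of_injective ?_)
    refine StrictMono.injective fun i j hij => ?_
    have := strict _ _ (hy i j hij).1 (hy i j hij).2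
    have := pos (y i)
    simp only [Function.comp, Fin.mk_lt_mk]
    omega
  · have h' : cnt a = cnt b := by
      have := pos a
      have := pos b
      simp only [Fin.mk.injEq] at h
      omega
    by_contra hn
    rcases lt_trichotomy a b with hab | hab | hab
    · exact (strict a b hab hn).ne h'
    · exact hn (hab ▸ .refl a)
    · exact (strict b a hab fun h => hn h.symm).ne' h'
  · simp only [congr a b h]

/-! ### Models of the theory of a pattern -/

/-- The block with index `i` is of kind `κ`. -/
structure HasKind (β : M → Fin n) (i : Fin n) (κ : BlockKind) : Prop where
  typ_eq : ∀ x, β x = i → typ x = κ.type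
  subsingleton : κ = .constSingleton → ∀ x y, β x = i → β y = i → x = y
  exists_gt : κ = .constDLO → ∀ x, β x = i → ∃ y, β y = i ∧ x < y
  exists_lt : κ = .constDLO → ∀ x, β x = i → ∃ y, β y = i ∧ y < x

/-- `β` numbers the blocks, and their kinds are given by `p`. -/
structure IsBlockMap (p : Fin n → BlockKind) (β : M → Fin n) : Prop extends IsBlockIndex β where
  hasKind : ∀ i, HasKind β i (p i)

theorem IsBlockIndex.models_blockAxioms_iff {β : M → Fin n} (h : IsBlockIndex β) {i : Fin n}
    {κ : BlockKind} : M ⊨ blockAxioms (i + 1) κ ↔ HasKind β i κ := by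
  -- Blocks are convex in a dense order, so the density axiom for a block is automatic and `HasKind`
  -- omits it.
  have hd : ∀ x y : M, β x = i → β y = i → x < y → ∃ z, β z = i ∧ x < z ∧ z < y := by
    intro x y hx hy hxy
    obtain ⟨z, hz⟩ := exists_between hxy
    exact ⟨z, le_antisymm (hy ▸ h.mono hz.2.le) (hx ▸ h.mono hz.1.le), hz⟩
  have e : HasKind β i κ ↔ (∀ x, β x = i → typ x = κ.type) ∧
      (κ = .constSingleton → ∀ x y, β x = i → β y = i → x = y) ∧
      (κ = .constDLO → ∀ x, β x = i → ∃ y, β y = i ∧ x < y) ∧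
      (κ = .constDLO → ∀ x, β x = i → ∃ y, β y = i ∧ y < x) :=
    ⟨fun ⟨a, b, c, d⟩ => ⟨a, b, c, d⟩, fun ⟨a, b, c, d⟩ => ⟨a, b, c, d⟩⟩
  rw [e]
  cases κ <;>
  simp [blockAxioms, Theory.model_iff, blockHasType, blockSubsingleton, blockDense, blockNoMax,
    blockNoMin, realize_allS, realize_ex1, h.realize_inBlock, Formula.realize_imp,
    Formula.realize_inf, realize_hasType, realize_lt, realize_eq, lt_iff,
    Fin.forall_fin_succ_pi, BlockKind.type, and_assoc]
  exact fun _ _ _ => hd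

theorem models_blockTheory_iff {p : Fin n → BlockKind} :
    M ⊨ blockTheory p ↔ ∃ β : M → Fin n, IsBlockMap p β := by
  have e : M ⊨ blockTheory p ↔ M ⊨ exactlyClasses n ∧
      ∀ i : Fin n, M ⊨ blockAxioms (i + 1) (p i) := by
    have := models_dloSigma M
    simp only [Theory.model_iff] at this ⊢
    simp only [blockTheory, Set.mem_union, Set.mem_singleton_iff, Set.mem_iUnion]
    constructor
    · exact fun h => ⟨h _ (.inl (.inr rfl)), fun i φ hφ => h _ (.inr ⟨i, hφ⟩)⟩
    · rintro ⟨h1, h2⟩ φ ((hφ | rfl) | ⟨i, hφ⟩)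
      exacts [this φ hφ, h1, h2 i φ hφ]
  rw [e]
  constructor
  · rintro ⟨h1, h2⟩
    rw [realize_exactlyClasses] at h1
    obtain ⟨β, hβ⟩ := exists_isBlockIndex h1.1 h1.2
    exact ⟨β, hβ, fun i => hβ.models_blockAxioms_iff.1 (h2 i)⟩
  · rintro ⟨β, hβ, hk⟩
    exact ⟨hβ.realize_exactlyClasses, fun i => hβ.models_blockAxioms_iff.2 (hk i)⟩

/-- A monotone surjection onto an alternation pattern that is compatible with the types numbers
the blocks. -/
theorem isBlockIndex_of_typ_eq {p : Fin n → BlockKind} (hp : IsAlternationPattern p)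
    {β : M → Fin n} (mono : Monotone β) (surj : Function.Surjective β)
    (ht : ∀ x, typ x = (p (β x)).type) : IsBlockIndex β := by
  refine ⟨mono, surj, fun {a b} => ⟨fun h e he => ?_, fun h => ?_⟩⟩
  · have : β e = β a := by
      rcases Set.mem_uIcc.1 he with h' | h'
      · exact le_antisymm (h ▸ mono h'.2) (mono h'.1)
      · exact le_antisymm (mono h'.2) (h ▸ mono h'.1)
    rw [ht, ht, this]
  · wlog hab : a ≤ b generalizing a b
    · exact (this h.symm (le_of_not_ge hab)).symm
    by_contra hne
    have hlt : β a < β b := lt_of_le_of_ne (mono hab) hne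
    obtain ⟨z, hz⟩ := surj ⟨β a + 1, by have := (β b).2; rw [Fin.lt_def] at hlt; omega⟩
    have haz : a < z := mono.reflect_lt (by rw [hz, Fin.lt_def]; exact Nat.lt_succ_self _)
    -- The point `min z b` lies in `[a, b]` and in the block right after that of `a`, including when
    -- this is the block of `b`; so adjacent blocks would share a type.
    refine hp.alternates (β a) (β (min z b)) ?_ ?_
    · rw [mono.map_min, min_eq_left, hz]
      rw [hz]
      exact hlt
    · rw [← ht, ← ht]
      exact (h (min z b) (Set.mem_uIcc_of_le (le_min haz.le hab) (min_le_right _ _))).symm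

/-- If `x ≤ e < σ(x)`, then `e < σ(x) ≤ σ(e)`; the decreasing case is symmetric. Thus blocks are
invariant under `σ`. -/
theorem approx_sigma (x : M) : Approx x (sigma x) := by
  intro e he
  rcases lt_trichotomy x (sigma x) with h | h | h
  · rw [Set.uIcc_of_le h.le] at he
    rw [typ_eq_inc.2 h, typ_eq_inc]
    rcases he.2.eq_or_lt with h2 | h2
    · rw [h2]
      exact sigma.lt_iff_lt.2 h
    · exact h2.trans_le (sigma.le_iff_le.2 he.1)
  · rw [← h, Set.uIcc_self, Set.mem_singleton_iff] at he
    rw [he]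
  · rw [Set.uIcc_of_ge h.le] at he
    rw [typ_eq_dec.2 h, typ_eq_dec]
    rcases he.1.eq_or_lt with h2 | h2
    · rw [← h2]
      exact sigma.lt_iff_lt.2 h
    · exact (sigma.le_iff_le.2 he.2).trans_lt h2

/-! ### Iterates of the automorphism -/

section Iterates

variable {M : Type*} [lang.Structure M] [AutOrder M]

/-- The `m`-th iterate of `σ`. -/
def iter (m : ℤ) : M ≃o M := sigma ^ m

@[simp] theorem iter_zero (x : M) : iter 0 x = x := by simp [iter]

theorem iter_one (x : M) : iter 1 x = sigma x := by simp [iter]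

theorem iter_add (m l : ℤ) (x : M) : iter (m + l) x = iter m (iter l x) := by
  simp [iter, zpow_add]

theorem iter_lt_iter_iff {m l : ℤ} {x y : M} : iter m x < iter l y ↔ iter (m - l) x < y := by
  rw [← (iter l).lt_iff_lt (x := iter (m - l) x), ← iter_add, add_sub_cancel]

theorem lt_iter_iff {m : ℤ} {x y : M} : x < iter m y ↔ iter (-m) x < y := by
  rw [← iter_zero x, iter_lt_iter_iff, iter_zero, zero_sub]

theorem strictMono_iter {x : M} (h : typ x = .inc) : StrictMono fun m => iter m x :=
  strictMono_int_of_lt_succ fun m => by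
    rw [iter_add, iter_one]
    exact (iter m).lt_iff_lt.2 (typ_eq_inc.1 h)

theorem strictAnti_iter {x : M} (h : typ x = .dec) : StrictAnti fun m => iter m x :=
  strictAnti_int_of_succ_lt fun m => by
    rw [iter_add, iter_one]
    exact (iter m).lt_iff_lt.2 (typ_eq_dec.1 h)

theorem iter_eq_self {x : M} (h : typ x = .const) (m : ℤ) : iter m x = x := by
  have h' := typ_eq_const.1 h
  induction m with
  | zero => simp
  | succ m ih => rw [iter_add, iter_one, h', ih]
  | pred m ih =>
    have : iter (-(m : ℤ) - 1) (iter 1 x) = x := by rwa [← iter_add, sub_add_cancel]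
    rwa [iter_one, h'] at this

theorem iter_lt_self_iff {x : M} {m : ℤ} :
    iter m x < x ↔ (typ x = .inc ∧ m < 0) ∨ (typ x = .dec ∧ 0 < m) := by
  cases h : typ x
  · simp [iter_eq_self h]
  · simpa using (strictMono_iter h).lt_iff_lt (a := m) (b := 0)
  · simpa using (strictAnti_iter h).lt_iff_gt (a := m) (b := 0)

theorem approx_iter (m : ℤ) (x : M) : Approx x (iter m x) := by
  induction m with
  | zero => simpa using .refl x
  | succ m ih =>
    rw [add_comm, iter_add, iter_one]
    exact ih.trans (approx_sigma _)
  | pred m ih =>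
    refine ih.trans ?_
    have : iter (-(m : ℤ)) x = sigma (iter (-(m : ℤ) - 1) x) := by
      rw [← iter_one, ← iter_add]
      congr 1
      abel_nf
    rw [this]
    exact (approx_sigma _).symm

end Iterates

theorem exists_term_realize_eq {α : Type*} (t : lang.Term α) : ∃ (i : α) (m : ℕ),
    ∀ (M : Type w) [lang.Structure M] [AutOrder M] (v : α → M), t.realize v = iter m (v i) := by
  induction t with
  | var i => exact ⟨i, 0, fun M _ _ v => by simp⟩
  | @func l f ts ih =>
    cases f with
    | sigma =>
      obtain ⟨i, m, h⟩ := ih 0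
      refine ⟨i, m + 1, fun M _ _ v => ?_⟩
      refine (funMap_sigma fun i => (ts i).realize v).trans ?_
      rw [h, ← iter_one, ← iter_add, add_comm]
      rfl

/-! ### The back-and-forth system -/

section BackAndForth

variable {M : Type*} {N : Type*} [lang.Structure M] [lang.Structure N] [AutOrder M] [AutOrder N]
  {n : ℕ} {p : Fin n → BlockKind} {β : M → Fin n} {β' : N → Fin n}

theorem IsBlockMap.exists_gt_of_ne (h : IsBlockMap p β) {i : Fin n} (hi : p i ≠ .constSingleton)
    {x : M} (hx : β x = i) : ∃ y, β y = i ∧ x < y := by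
  have ht := (h.hasKind i).typ_eq x hx
  cases hp : p i with
  | constSingleton => exact absurd hp hi
  | constDLO => exact (h.hasKind i).exists_gt hp x hx
  | inc =>
    rw [hp] at ht
    exact ⟨sigma x, (h.eq_iff.2 (approx_sigma x)).symm.trans hx, typ_eq_inc.1 ht⟩
  | dec =>
    rw [hp] at ht
    refine ⟨iter (-1) x, (h.eq_iff.2 (approx_iter _ x)).symm.trans hx, ?_⟩
    simpa using strictAnti_iter ht (show (-1 : ℤ) < 0 by simp)

theorem IsBlockMap.exists_lt_of_ne (h : IsBlockMap p β) {i : Fin n} (hi : p i ≠ .constSingleton)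
    {x : M} (hx : β x = i) : ∃ y, β y = i ∧ y < x := by
  have ht := (h.hasKind i).typ_eq x hx
  cases hp : p i with
  | constSingleton => exact absurd hp hi
  | constDLO => exact (h.hasKind i).exists_lt hp x hx
  | dec =>
    rw [hp] at ht
    exact ⟨sigma x, (h.eq_iff.2 (approx_sigma x)).symm.trans hx, typ_eq_dec.1 ht⟩
  | inc =>
    rw [hp] at ht
    refine ⟨iter (-1) x, (h.eq_iff.2 (approx_iter _ x)).symm.trans hx, ?_⟩
    simpa using strictMono_iter ht (show (-1 : ℤ) < 0 by simp)

theorem IsBlockMap.exists_between_finsets (h : IsBlockMap p β) {i : Fin n}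
    (hp : p i ≠ .constSingleton) (lo hi : Finset M) (hlo : ∀ x ∈ lo, β x = i)
    (hhi : ∀ x ∈ hi, β x = i) (hlt : ∀ x ∈ lo, ∀ y ∈ hi, x < y) :
    ∃ b, β b = i ∧ (∀ x ∈ lo, x < b) ∧ ∀ y ∈ hi, b < y := by
  have : DenselyOrdered {x // β x = i} := ⟨fun a b hab => by
    obtain ⟨z, hz⟩ := exists_between (show a.1 < b.1 from hab)
    exact ⟨⟨z, le_antisymm (b.2 ▸ h.mono hz.2.le) (a.2 ▸ h.mono hz.1.le)⟩, hz⟩⟩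
  have : NoMaxOrder {x // β x = i} := ⟨fun a => by
    obtain ⟨y, hy, hlt⟩ := h.exists_gt_of_ne hp a.2
    exact ⟨⟨y, hy⟩, hlt⟩⟩
  have : NoMinOrder {x // β x = i} := ⟨fun a => by
    obtain ⟨y, hy, hlt⟩ := h.exists_lt_of_ne hp a.2
    exact ⟨⟨y, hy⟩, hlt⟩⟩
  have : Nonempty {x // β x = i} := by
    obtain ⟨y, hy⟩ := h.surj i
    exact ⟨⟨y, hy⟩⟩
  obtain ⟨b, hb⟩ := Order.exists_between_finsets (lo.subtype (β · = i)) (hi.subtype (β · = i))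
    fun x hx y hy => hlt _ (Finset.mem_subtype.1 hx) _ (Finset.mem_subtype.1 hy)
  exact ⟨b, b.2, fun x hx => hb.1 ⟨x, hlo x hx⟩ (Finset.mem_subtype.2 hx),
    fun x hx => hb.2 ⟨x, hhi x hx⟩ (Finset.mem_subtype.2 hx)⟩

theorem IsBlockIndex.lt_iff_lt_of_ne (h : IsBlockIndex β) {x y : M} (hne : β x ≠ β y) :
    x < y ↔ β x < β y :=
  ⟨fun hxy => lt_of_le_of_ne (h.mono hxy.le) hne, fun hlt => h.mono.reflect_lt hlt⟩

/-- Points in other blocks compare according to block numbers alone, so only points in the block of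
`a` matter. If `a` is none of the given points, a singleton block leaves no further constraint, and
any other block is dense without endpoints, so finitely many bounds can be met. -/
theorem IsBlockMap.exists_same_cut (h : IsBlockMap p β) (h' : IsBlockMap p β') {κ : Type*}
    [Finite κ] (P : κ → M) (Q : κ → N) (hβ : ∀ s, β (P s) = β' (Q s))
    (hlt : ∀ s t, P s < P t ↔ Q s < Q t) (a : M) :
    ∃ b, β' b = β a ∧ ∀ s, (P s < a ↔ Q s < b) ∧ (a < P s ↔ b < Q s) := by
  classical
  have := Fintype.ofFinite κ
  by_cases hs : ∃ s, P s = a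
  · obtain ⟨s, rfl⟩ := hs
    exact ⟨Q s, (hβ s).symm, fun t => ⟨hlt t s, hlt s t⟩⟩
  push Not at hs
  have hne : ∀ b, β' b = β a → ∀ s, β (P s) ≠ β a →
      (P s < a ↔ Q s < b) ∧ (a < P s ↔ b < Q s) := fun b hb s hs => by
    rw [h.lt_iff_lt_of_ne hs, h.lt_iff_lt_of_ne hs.symm, h'.lt_iff_lt_of_ne (by rwa [← hβ, hb]),
      h'.lt_iff_lt_of_ne (by rw [← hβ, hb]; exact hs.symm), hβ, hb]
    exact ⟨Iff.rfl, Iff.rfl⟩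
  by_cases hp : p (β a) = .constSingleton
  · obtain ⟨b, hb⟩ := h'.surj (β a)
    exact ⟨b, hb, fun s => hne b hb s fun hsa =>
      hs s ((h.hasKind _).subsingleton hp _ _ hsa rfl)⟩
  · obtain ⟨b, hb, hlo, hhi⟩ := h'.exists_between_finsets hp
      ((Finset.univ.filter fun s => β (P s) = β a ∧ P s < a).image Q)
      ((Finset.univ.filter fun s => β (P s) = β a ∧ a < P s).image Q)
      (fun x hx => by
        obtain ⟨s, hs, rfl⟩ := Finset.mem_image.1 hx
        rw [← hβ, (Finset.mem_filter.1 hs).2.1])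
      (fun x hx => by
        obtain ⟨s, hs, rfl⟩ := Finset.mem_image.1 hx
        rw [← hβ, (Finset.mem_filter.1 hs).2.1])
      (by
        simp only [Finset.mem_image, Finset.mem_filter, Finset.mem_univ, true_and]
        rintro _ ⟨s, ⟨-, hs⟩, rfl⟩ _ ⟨t, ⟨-, ht⟩, rfl⟩
        exact (hlt s t).1 (hs.trans ht))
    refine ⟨b, hb, fun s => ?_⟩
    by_cases hsa : β (P s) = β a
    · rcases lt_or_gt_of_ne (hs s) with hl | hl
      · have := hlo (Q s) (Finset.mem_image_of_mem _ (by simp [hsa, hl]))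
        simp [hl, this, hl.not_gt, this.not_gt]
      · have := hhi (Q s) (Finset.mem_image_of_mem _ (by simp [hsa, hl]))
        simp [hl, this, hl.not_gt, this.not_gt]
    · exact hne b hb s hsa

/-- Two families of points have the same block indices, and their iterates up to `K` are ordered
in the same way. -/
structure Sim (β : M → Fin n) (β' : N → Fin n) (K : ℕ) {ι : Type*} (x : ι → M) (y : ι → N) :
    Prop where
  index_eq : ∀ i, β (x i) = β' (y i)
  lt_iff : ∀ i j (m : ℤ), m.natAbs ≤ K → (iter m (x i) < x j ↔ iter m (y i) < y j)

variable {ι : Type*} {x : ι → M} {y : ι → N} {K : ℕ}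

theorem Sim.symm (h : Sim β β' K x y) : Sim β' β K y x :=
  ⟨fun i => (h.index_eq i).symm, fun i j m hm => (h.lt_iff i j m hm).symm⟩

theorem Sim.anti (h : Sim β β' K x y) {K' : ℕ} (hK : K' ≤ K) : Sim β β' K' x y :=
  ⟨h.index_eq, fun i j m hm => h.lt_iff i j m (hm.trans hK)⟩

theorem Sim.iter_lt_iter_iff (h : Sim β β' K x y) {i j : ι} {m l : ℤ} (hm : (m - l).natAbs ≤ K) :
    iter m (x i) < iter l (x j) ↔ iter m (y i) < iter l (y j) := by
  rw [AutOrder.iter_lt_iter_iff, AutOrder.iter_lt_iter_iff, h.lt_iff i j _ hm]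

theorem Sim.iter_eq_iter_iff (h : Sim β β' K x y) {i j : ι} {m l : ℤ} (hm : (m - l).natAbs ≤ K) :
    iter m (x i) = iter l (x j) ↔ iter m (y i) = iter l (y j) := by
  rw [eq_iff_le_not_lt, eq_iff_le_not_lt, ← not_lt, ← not_lt, h.iter_lt_iter_iff hm,
    h.iter_lt_iter_iff (by omega)]

/-- The cut of `a` is taken over all iterates with exponents in `[-K, K]`. Comparing two such
iterates involves a difference of exponents of size at most `2K`, which is why the bound is halved.
-/
theorem Sim.exists_snoc (hβ : IsBlockMap p β) (hβ' : IsBlockMap p β') {α : Type*} [Finite α]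
    {k : ℕ} {v : α → M} {v' : α → N} {xs : Fin k → M} {xs' : Fin k → N}
    (h : Sim β β' (2 * K) (Sum.elim v xs) (Sum.elim v' xs')) (a : M) :
    ∃ b : N, Sim β β' K (Sum.elim v (Fin.snoc xs a)) (Sum.elim v' (Fin.snoc xs' b)) := by
  obtain ⟨b, hb, hcut⟩ := hβ.exists_same_cut hβ' (κ := (α ⊕ Fin k) × Set.Icc (-(K : ℤ)) K)
    (fun s => iter s.2 (Sum.elim v xs s.1)) (fun s => iter s.2 (Sum.elim v' xs' s.1))
    (fun s => by
      rw [← hβ.eq_iff.2 (approx_iter _ _), ← hβ'.eq_iff.2 (approx_iter _ _), h.index_eq])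
    (fun ⟨i, m, hm⟩ ⟨j, l, hl⟩ => h.iter_lt_iter_iff (by
      rw [Set.mem_Icc] at hm hl
      simp only
      omega)) a
  have ht : typ a = typ b := by
    rw [(hβ.hasKind _).typ_eq a rfl, (hβ'.hasKind _).typ_eq b rfl, hb]
  have key : ∀ i (m : ℤ), m.natAbs ≤ K →
      (iter m (Sum.elim v xs i) < a ↔ iter m (Sum.elim v' xs' i) < b) ∧
      (iter m a < Sum.elim v xs i ↔ iter m b < Sum.elim v' xs' i) := by
    intro i m hm
    refine ⟨(hcut ⟨i, m, by rw [Set.mem_Icc]; omega⟩).1, ?_⟩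
    -- Comparing `σ^m(a)` with a point is comparing `a` with its iterate of exponent `-m`; hence the
    -- symmetric range.
    have := (hcut ⟨i, -m, by rw [Set.mem_Icc]; omega⟩).2
    simpa only [lt_iter_iff, neg_neg] using this
  have self : ∀ m : ℤ, iter m a < a ↔ iter m b < b := fun m => by
    rw [iter_lt_self_iff, iter_lt_self_iff, ht]
  have cases : ∀ i : α ⊕ Fin (k + 1),
      (∃ j : α ⊕ Fin k, Sum.elim v (Fin.snoc xs a : Fin (k + 1) → M) i = Sum.elim v xs j ∧
        Sum.elim v' (Fin.snoc xs' b : Fin (k + 1) → N) i = Sum.elim v' xs' j) ∨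
      (Sum.elim v (Fin.snoc xs a : Fin (k + 1) → M) i = a ∧
        Sum.elim v' (Fin.snoc xs' b : Fin (k + 1) → N) i = b) := by
    rintro (i | i)
    · exact .inl ⟨.inl i, rfl, rfl⟩
    · induction i using Fin.lastCases with
      | last => exact .inr (by simp)
      | cast i => exact .inl ⟨.inr i, by simp⟩
  refine ⟨b, fun i => ?_, fun i j m hm => ?_⟩
  · rcases cases i with ⟨i', h1, h2⟩ | ⟨h1, h2⟩ <;> rw [h1, h2]
    · exact h.index_eq i'
    · exact hb.symm
  · rcases cases i with ⟨i', h1, h2⟩ | ⟨h1, h2⟩ <;> rcases cases j with ⟨j', h3, h4⟩ | ⟨h3, h4⟩ <;>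
      rw [h1, h2, h3, h4]
    · exact h.lt_iff i' j' m (by omega)
    · exact (key i' m hm).1
    · exact (key j' m hm).2
    · exact self m

end BackAndForth

/-- Each quantifier doubles the bound and is handled by one back-and-forth step. Since `K` is chosen
before the models, the lemma serves for completeness, model completeness and weak o-minimality
alike. -/
theorem exists_sim_realize_iff {n : ℕ} (p : Fin n → BlockKind) {α : Type*} [Finite α] {k : ℕ}
    (φ : lang.BoundedFormula α k) : ∃ K : ℕ, ∀ (M N : Type w) [lang.Structure M] [lang.Structure N]
      [AutOrder M] [AutOrder N] (β : M → Fin n) (β' : N → Fin n), IsBlockMap p β →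
      IsBlockMap p β' → ∀ (v : α → M) (v' : α → N) (xs : Fin k → M) (xs' : Fin k → N),
      Sim β β' K (Sum.elim v xs) (Sum.elim v' xs') → (φ.Realize v xs ↔ φ.Realize v' xs') := by
  induction φ with
  | falsum => exact ⟨0, fun _ _ _ _ _ _ _ _ _ _ _ _ _ _ _ => Iff.rfl⟩
  | equal t₁ t₂ =>
    obtain ⟨i, m, hi⟩ := exists_term_realize_eq.{w} t₁
    obtain ⟨j, l, hj⟩ := exists_term_realize_eq.{w} t₂
    refine ⟨m + l, fun M N _ _ _ _ β β' _ _ v v' xs xs' h => ?_⟩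
    simp only [BoundedFormula.Realize, hi, hj]
    exact h.iter_eq_iter_iff (by omega)
  | rel R ts =>
    cases R with
    | lt =>
      obtain ⟨i, m, hi⟩ := exists_term_realize_eq.{w} (ts 0)
      obtain ⟨j, l, hj⟩ := exists_term_realize_eq.{w} (ts 1)
      refine ⟨m + l, fun M N _ _ _ _ β β' _ _ v v' xs xs' h => ?_⟩
      have key : ∀ (A : Type w) [lang.Structure A] [AutOrder A] (u : _ → A),
          Structure.RelMap ltSymb (fun i => (ts i).realize u) ↔
            iter m (u i) < iter l (u j) := fun A _ _ u => by
        rw [← hi, ← hj, ← AutOrder.lt_iff, Lt]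
        congr! 1
        ext i
        fin_cases i <;> rfl
      exact (key M _).trans ((h.iter_lt_iter_iff (by omega)).trans (key N _).symm)
  | imp φ ψ ihφ ihψ =>
    obtain ⟨K, hK⟩ := ihφ
    obtain ⟨L, hL⟩ := ihψ
    refine ⟨max K L, fun M N _ _ _ _ β β' hβ hβ' v v' xs xs' h => ?_⟩
    simp only [BoundedFormula.realize_imp]
    rw [hK M N β β' hβ hβ' v v' xs xs' (h.anti (le_max_left _ _)),
      hL M N β β' hβ hβ' v v' xs xs' (h.anti (le_max_right _ _))]
  | all φ ih =>
    obtain ⟨K, hK⟩ := ih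
    refine ⟨2 * K, fun M N _ _ _ _ β β' hβ hβ' v v' xs xs' h => ?_⟩
    simp only [BoundedFormula.realize_all]
    constructor
    · intro H b
      obtain ⟨a, ha⟩ := h.symm.exists_snoc hβ' hβ b
      exact (hK M N β β' hβ hβ' _ _ _ _ ha.symm).1 (H a)
    · intro H a
      obtain ⟨b, hb⟩ := h.exists_snoc hβ hβ' a
      exact (hK M N β β' hβ hβ' _ _ _ _ hb).2 (H b)

theorem exists_sim_formula_realize_iff {n : ℕ} (p : Fin n → BlockKind) {α : Type*} [Finite α]
    (φ : lang.Formula α) : ∃ K : ℕ, ∀ (M N : Type w) [lang.Structure M] [lang.Structure N]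
      [AutOrder M] [AutOrder N] (β : M → Fin n) (β' : N → Fin n), IsBlockMap p β →
      IsBlockMap p β' → ∀ (v : α → M) (v' : α → N),
      Sim β β' K v v' → (φ.Realize v ↔ φ.Realize v') := by
  obtain ⟨K, hK⟩ := exists_sim_realize_iff.{w} p φ
  refine ⟨K, fun M N _ _ _ _ β β' hβ hβ' v v' h => hK M N β β' hβ hβ' v v' _ _ ?_⟩
  refine ⟨?_, ?_⟩
  · rintro (i | i)
    · exact h.index_eq i
    · exact i.elim0
  · rintro (i | i) (j | j) m hm
    · exact h.lt_iff i j m hm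
    · exact j.elim0
    · exact i.elim0
    · exact i.elim0

/-! ### Embeddings -/

section Embedding

variable {M : Type*} {N : Type*} [lang.Structure M] [lang.Structure N] [AutOrder M] [AutOrder N]

theorem relMap_ltSymb_iff (u : Fin 2 → M) : Structure.RelMap ltSymb u ↔ u 0 < u 1 := by
  rw [← AutOrder.lt_iff, Lt]
  congr! 1
  ext i
  fin_cases i <;> rfl

theorem map_lt_iff (f : M ↪[lang] N) {a b : M} : f a < f b ↔ a < b := by
  exact (relMap_ltSymb_iff (f ∘ ![a, b])).symm.trans
    ((f.map_rel ltSymb ![a, b]).trans (relMap_ltSymb_iff _))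

theorem map_sigma (f : M ↪[lang] N) (a : M) : f (sigma a) = sigma (f a) := by
  have h := f.map_fun sigmaSymb ![a]
  rwa [funMap_sigma, funMap_sigma] at h

theorem map_iter (f : M ↪[lang] N) (m : ℤ) (a : M) : f (iter m a) = iter m (f a) := by
  induction m with
  | zero => simp
  | succ m ih => rw [add_comm, iter_add, iter_add, iter_one, iter_one, map_sigma, ih]
  | pred m ih =>
    apply (iter (1 : ℤ)).injective
    rw [iter_one, ← map_sigma, ← iter_one, ← iter_add, ← iter_add, add_sub_cancel, ih]

theorem typ_map (f : M ↪[lang] N) (a : M) : typ (f a) = typ a := by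
  simp only [typ, ← map_sigma, map_lt_iff, f.injective.eq_iff]

/-- A strictly monotone map that commutes with `σ`, as an embedding. -/
def embeddingOfStrictMono (f : M → N) (hf : StrictMono f)
    (hs : ∀ x, f (sigma x) = sigma (f x)) : M ↪[lang] N where
  toFun := f
  inj' := hf.injective
  map_fun' {k} g x := by
    cases g with
    | sigma => exact (congrArg f (funMap_sigma x)).trans ((hs _).trans (funMap_sigma (f ∘ x)).symm)
  map_rel' {k} r x := by
    cases r with
    | lt =>
      exact (relMap_ltSymb_iff (f ∘ x)).trans (hf.lt_iff_lt.trans (relMap_ltSymb_iff x).symm)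

variable {n : ℕ} {p : Fin n → BlockKind} {β : M → Fin n} {β' : N → Fin n}

/-- Representatives of the `n` blocks are sent to blocks in weakly increasing order. Merging two of
them would merge two neighbours, whose types differ while `f` preserves types. So the induced
self-map of `Fin n` is strictly increasing, hence the identity. -/
theorem IsBlockMap.index_map (hp : IsAlternationPattern p) (h : IsBlockMap p β)
    (h' : IsBlockMap p β') (f : M ↪[lang] N) (x : M) : β' (f x) = β x := by
  classical
  obtain ⟨g, hg⟩ : ∃ g : Fin n → M, ∀ i, β (g i) = i :=
    h.surj.hasRightInverse
  -- The representatives are adjusted so that `x` represents its own block.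
  let y : Fin n → M := Function.update g (β x) x
  have hy : ∀ i, β (y i) = i := fun i => by
    by_cases hi : i = β x
    · simp [y, hi]
    · simp [y, hi, hg i]
  have hmono : Monotone fun i => β' (f (y i)) := fun i j hij => by
    rcases hij.eq_or_lt with rfl | hij
    · rfl
    · exact h'.mono ((map_lt_iff f).2 (h.mono.reflect_lt (by rwa [hy, hy]))).le
  have hst : StrictMono fun i => β' (f (y i)) := fun i j hij => by
    refine lt_of_le_of_ne (hmono hij.le) fun he => ?_
    rw [Fin.lt_def] at hij
    let k : Fin n := ⟨i + 1, by omega⟩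
    have hik : β' (f (y i)) = β' (f (y k)) := by
      refine le_antisymm (hmono ?_) ((hmono ?_).trans he.ge)
      · rw [Fin.le_def]; simp [k]
      · rw [Fin.le_def]; exact hij
    refine hp.alternates i k rfl ?_
    rw [← (h.hasKind i).typ_eq _ (hy i), ← (h.hasKind k).typ_eq _ (hy k), ← typ_map f,
      ← typ_map f (y k), (h'.hasKind _).typ_eq _ rfl, (h'.hasKind _).typ_eq _ rfl, hik]
  have hid : (fun i => β' (f (y i))) = id := by
    have := Subsingleton.elim
      (hst.orderIsoOfSurjective _ (Finite.surjective_of_injective hst.injective)) (OrderIso.refl _)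
    exact congrArg (fun e : Fin n ≃o Fin n => (e : Fin n → Fin n)) this
  simpa [y] using congrFun hid (β x)

theorem IsBlockMap.sim_map (hp : IsAlternationPattern p) (h : IsBlockMap p β)
    (h' : IsBlockMap p β') (f : M ↪[lang] N) (K : ℕ) {ι : Type*} (x : ι → M) :
    Sim β' β K (f ∘ x) x :=
  ⟨fun i => h.index_map hp h' f (x i), fun i j m _ => by
    simp only [Function.comp, ← map_iter, map_lt_iff]⟩

end Embedding

end AutOrder

open AutOrder

/-! ### The theory of a pattern is model complete and weakly o-minimal -/

section

variable {n : ℕ} {p : Fin n → BlockKind}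

theorem dloSigma_subset_blockTheory : dloSigma ⊆ blockTheory p :=
  fun _ h => .inl (.inl h)

theorem exists_isBlockMap (p : Fin n → BlockKind) (M : Type*) [lang.Structure M]
    [M ⊨ blockTheory p] : ∃ (_ : AutOrder M) (β : M → Fin n), IsBlockMap p β := by
  have : M ⊨ dloSigma := Theory.Model.mono ‹M ⊨ blockTheory p› dloSigma_subset_blockTheory
  obtain ⟨h⟩ := nonempty_autOrder M
  exact ⟨h, models_blockTheory_iff.1 ‹M ⊨ blockTheory p›⟩

theorem isModelComplete_blockTheory (hp : IsAlternationPattern p) :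
    Theory.IsModelComplete.{w} (blockTheory p) := by
  intro M N _ _ _ _ _ _ f k φ x
  obtain ⟨_, β, hβ⟩ := exists_isBlockMap p M
  obtain ⟨_, β', hβ'⟩ := exists_isBlockMap p N
  obtain ⟨K, hK⟩ := exists_sim_formula_realize_iff.{w} p φ
  exact hK N M β' β hβ' hβ _ _ (hβ.sim_map hp hβ' f K x)

theorem isWeaklyOMinimal_blockTheory : IsWeaklyOMinimal.{w} (blockTheory p) := by
  intro M _ _ _
  obtain ⟨_, β, hβ⟩ := exists_isBlockMap p M
  have hLt : (Lt : M → M → Prop) = (· < ·) := by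
    ext a b
    exact lt_iff a b
  refine ⟨by rw [hLt]; infer_instance, fun S hS => ?_⟩
  obtain ⟨A, -, hA⟩ := Set.definable_iff_finitely_definable.1 hS
  obtain ⟨φ, hφ⟩ := Set.definable_iff_exists_formula_sum.1 hA
  have hmem : ∀ x, x ∈ S ↔ φ.Realize (Sum.elim (fun a => (a : M)) fun _ => x) := fun x =>
    Set.ext_iff.1 hφ fun _ => x
  obtain ⟨K, hK⟩ := exists_sim_formula_realize_iff.{w} p φ
  -- The signature takes finitely many values and determines the `K`-similarity class of `x` over
  -- the parameters; each component is monotone or antitone in `x`, so its fibres are convex.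
  let sig : M → Fin n × (↥(A : Set M) × Set.Icc (-(K : ℤ)) K → Prop × Prop) := fun x =>
    (β x, fun s => (iter s.2 (s.1 : M) < x, x < iter s.2 (s.1 : M)))
  have hsig : ∀ x y, sig x = sig y → (x ∈ S ↔ y ∈ S) := by
    intro x y h
    simp only [sig, Prod.mk.injEq, funext_iff, Prod.forall, Subtype.forall, Set.mem_Icc,
      eq_iff_iff] at h
    obtain ⟨h1, h2⟩ := h
    rw [hmem, hmem]
    refine hK M M β β hβ hβ _ _ ⟨?_, ?_⟩
    · rintro (i | i)
      · rfl
      · exact h1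
    · rintro (i | i) (j | j) m hm
      · rfl
      · exact (h2 i i.2 m (by omega)).1
      · have := (h2 j j.2 (-m) (by omega)).2
        rwa [lt_iter_iff, lt_iter_iff, neg_neg] at this
      · simp only [Sum.elim_inr, iter_lt_self_iff]
        rw [(hβ.hasKind _).typ_eq x rfl, (hβ.hasKind _).typ_eq y rfl, h1]
  refine ⟨(fun c => sig ⁻¹' {c}) '' (sig '' S), Set.toFinite _, ?_, ?_⟩
  · rintro _ ⟨c, -, rfl⟩ x rfl z hz y hxy hyz
    rw [lt_iff] at hxy hyz
    have hz' := Prod.ext_iff.1 hz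
    simp only [sig] at hz'
    refine Prod.ext (le_antisymm ?_ (hβ.mono hxy.le)) (funext fun s => Prod.ext ?_ ?_)
    · exact (hβ.mono hyz.le).trans hz'.1.le
    · refine propext ⟨fun h => ?_, fun h => h.trans hxy⟩
      exact (congrArg Prod.fst (congrFun hz'.2 s)).mp (h.trans hyz)
    · refine propext ⟨fun h => hxy.trans h, fun h => hyz.trans ?_⟩
      exact (congrArg Prod.snd (congrFun hz'.2 s)).mpr h
  · ext x
    simp only [Set.sUnion_image, Set.mem_iUnion, Set.mem_image, Set.mem_preimage,
      Set.mem_singleton_iff]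
    exact ⟨fun h => ⟨_, ⟨x, h, rfl⟩, rfl⟩, fun ⟨_, ⟨y, hy, rfl⟩, h⟩ => (hsig x y h).2 hy⟩

end

/-! ### The theory of a pattern is consistent -/

section

variable {n : ℕ} (p : Fin n → BlockKind)

/-- The lexicographic sum of a point for each singleton block and a copy of `ℚ` for each other
block of a pattern. -/
abbrev PatternModel : Type :=
  {x : Fin n ×ₗ ℚ // p (ofLex x).1 = .constSingleton → (ofLex x).2 = 0}

/-- The translation of `ℚ` by which the automorphism acts on a block. -/
def BlockKind.shift : BlockKind → ℚ
  | .constSingleton => 0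
  | .constDLO => 0
  | .inc => 1
  | .dec => -1

namespace PatternModel

variable {p}

/-- The point `q` of block `i`. -/
def mk (i : Fin n) (q : ℚ) (h : p i = .constSingleton → q = 0) : PatternModel p :=
  ⟨toLex (i, q), h⟩

/-- The index of the block of a point. -/
def index (x : PatternModel p) : Fin n := (ofLex x.1).1

/-- The coordinate of a point in its block. -/
def coord (x : PatternModel p) : ℚ := (ofLex x.1).2

theorem coord_eq_zero {x : PatternModel p} (h : p x.index = .constSingleton) : x.coord = 0 := x.2 h

theorem lt_iff {x y : PatternModel p} :
    x < y ↔ x.index < y.index ∨ x.index = y.index ∧ x.coord < y.coord :=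
  Prod.Lex.lt_iff

theorem ext_iff {x y : PatternModel p} : x = y ↔ x.index = y.index ∧ x.coord = y.coord := by
  rw [Subtype.ext_iff, ← ofLex_inj, Prod.ext_iff]
  rfl

@[simp] theorem index_mk {i : Fin n} {q : ℚ} {h} : (mk i q h : PatternModel p).index = i := rfl

@[simp] theorem coord_mk {i : Fin n} {q : ℚ} {h} : (mk i q h : PatternModel p).coord = q := rfl

theorem index_mono : Monotone (index : PatternModel p → Fin n) := fun x y h => by
  rcases h.eq_or_lt with rfl | h
  · rfl
  · rcases lt_iff.1 h with h | h
    exacts [h.le, h.1.le]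

/-- The automorphism. -/
noncomputable def auto : PatternModel p ≃o PatternModel p :=
  StrictMono.orderIsoOfSurjective
    (fun x => mk x.index (x.coord + (p x.index).shift) fun h => by
      rw [coord_eq_zero h, h]; simp [BlockKind.shift])
    (fun x y h => by
      rw [lt_iff] at h ⊢
      refine h.imp id fun ⟨h1, h2⟩ => ⟨h1, ?_⟩
      simp only [coord_mk, h1]
      linarith)
    (fun x => ⟨mk x.index (x.coord - (p x.index).shift) fun h => by
      rw [coord_eq_zero h, h]; simp [BlockKind.shift], by simp [ext_iff]⟩)

theorem index_auto (x : PatternModel p) : (auto x).index = x.index := rfl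

theorem coord_auto (x : PatternModel p) : (auto x).coord = x.coord + (p x.index).shift := rfl

noncomputable instance : lang.Structure (PatternModel p) where
  funMap {k} f := match k, f with
    | _, Func.sigma => fun x => auto (x 0)
  RelMap {k} r := match k, r with
    | _, Rel.lt => fun x => x 0 < x 1

theorem exists_gt_of_ne (x : PatternModel p) (h : p x.index ≠ .constSingleton) :
    ∃ y, y.index = x.index ∧ x < y :=
  ⟨mk x.index (x.coord + 1) fun h' => absurd h' h, rfl, lt_iff.2 (by simp)⟩

theorem exists_lt_of_ne (x : PatternModel p) (h : p x.index ≠ .constSingleton) :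
    ∃ y, y.index = x.index ∧ y < x :=
  ⟨mk x.index (x.coord - 1) fun h' => absurd h' h, rfl, lt_iff.2 (by simp)⟩

/-- The pattern model as a dense linear order without endpoints with an automorphism. -/
@[reducible]
noncomputable def autOrder (hp : IsAlternationPattern p) : AutOrder (PatternModel p) where
  sigma := auto
  lt_iff _ _ := Iff.rfl
  funMap_sigma _ := rfl
  noMax := ⟨fun x => by
    by_cases h : p x.index = .constSingleton
    · refine ⟨mk ⟨x.index + 1, (hp.interior _ h).2⟩ 0 fun _ => rfl, lt_iff.2 (.inl ?_)⟩
      rw [Fin.lt_def]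
      simp
    · obtain ⟨y, -, hy⟩ := exists_gt_of_ne x h
      exact ⟨y, hy⟩⟩
  noMin := ⟨fun x => by
    by_cases h : p x.index = .constSingleton
    · have := (hp.interior _ h).1
      refine ⟨mk ⟨x.index - 1, by omega⟩ 0 fun _ => rfl, lt_iff.2 (.inl ?_)⟩
      rw [Fin.lt_def]
      simp only [index_mk]
      omega
    · obtain ⟨y, -, hy⟩ := exists_lt_of_ne x h
      exact ⟨y, hy⟩⟩
  dense := ⟨fun x y hxy => by
    rcases lt_iff.1 hxy with h | ⟨h1, h2⟩
    · by_cases hx : p x.index = .constSingleton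
      · by_cases hy : p y.index = .constSingleton
        · have hne : (x.index : ℕ) + 1 ≠ y.index := fun he =>
            hp.alternates _ _ he (by rw [hx, hy])
          rw [Fin.lt_def] at h
          refine ⟨mk ⟨x.index + 1, by omega⟩ 0 fun _ => rfl, lt_iff.2 (.inl ?_),
            lt_iff.2 (.inl ?_)⟩
          · rw [Fin.lt_def]; simp
          · rw [Fin.lt_def]; simp only [index_mk]; omega
        · obtain ⟨z, hz, hlt⟩ := exists_lt_of_ne y hy
          exact ⟨z, lt_iff.2 (.inl (hz ▸ h)), hlt⟩
      · obtain ⟨z, hz, hlt⟩ := exists_gt_of_ne x hx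
        exact ⟨z, hlt, lt_iff.2 (.inl (hz ▸ h))⟩
    · have hx : p x.index ≠ .constSingleton := fun hx => by
        rw [coord_eq_zero hx, coord_eq_zero (h1 ▸ hx)] at h2
        exact h2.false
      refine ⟨mk x.index ((x.coord + y.coord) / 2) fun h => absurd h hx,
        lt_iff.2 (.inr ⟨rfl, ?_⟩), lt_iff.2 (.inr ⟨h1, ?_⟩)⟩ <;> simp only [coord_mk] <;> linarith⟩

theorem models_blockTheory (hp : IsAlternationPattern p) : PatternModel p ⊨ blockTheory p := by
  let := autOrder hp
  rw [models_blockTheory_iff]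
  have htyp : ∀ x : PatternModel p, typ x = (p x.index).type := by
    intro x
    have hs : (sigma x : PatternModel p) = auto x := rfl
    cases hx : p x.index
    · rw [BlockKind.type, typ_eq_const, hs, ext_iff]
      simp [index_auto, coord_auto, hx, BlockKind.shift]
    · rw [BlockKind.type, typ_eq_const, hs, ext_iff]
      simp [index_auto, coord_auto, hx, BlockKind.shift]
    · rw [BlockKind.type, typ_eq_inc, hs]
      refine lt_iff.2 (.inr ⟨rfl, ?_⟩)
      simp [coord_auto, hx, BlockKind.shift]
    · rw [BlockKind.type, typ_eq_dec, hs]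
      refine lt_iff.2 (.inr ⟨rfl, ?_⟩)
      simp [coord_auto, hx, BlockKind.shift]
  refine ⟨index, isBlockIndex_of_typ_eq hp index_mono (fun i => ⟨mk i 0 fun _ => rfl, rfl⟩) htyp,
    fun i => ⟨?_, ?_, ?_, ?_⟩⟩
  · rintro x rfl
    exact htyp x
  · rintro h x y rfl hy
    exact ext_iff.2 ⟨hy.symm, by rw [coord_eq_zero h, coord_eq_zero (hy ▸ h)]⟩
  · rintro h x rfl
    exact exists_gt_of_ne x (by simp [h])
  · rintro h x rfl
    exact exists_lt_of_ne x (by simp [h])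

end PatternModel

variable {p}

/-- Empty tuples are similar for every bound, so any two models agree on all sentences;
`PatternModel` gives consistency. -/
theorem isComplete_blockTheory (hp : IsAlternationPattern p) : (blockTheory p).IsComplete := by
  have hM := PatternModel.models_blockTheory hp
  have : Nonempty (PatternModel p) := ⟨PatternModel.mk ⟨0, hp.pos⟩ 0 fun _ => rfl⟩
  refine Theory.IsComplete.isComplete_iff_models_elementarily_equivalent.2
    ⟨Theory.Model.isSatisfiable (PatternModel p), fun M N => ?_⟩
  obtain ⟨_, β, hβ⟩ := exists_isBlockMap p M
  obtain ⟨_, β', hβ'⟩ := exists_isBlockMap p N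
  refine elementarilyEquivalent_iff.2 fun φ => ?_
  obtain ⟨K, hK⟩ := exists_sim_formula_realize_iff.{0} p φ
  exact hK M N β β' hβ hβ' _ _ ⟨fun i => i.elim, fun i => i.elim⟩

end

end OrdAut

/-! ### Elements of the same type and ultrapowers -/

namespace FirstOrder.Language

open Filter

variable {L : Language.{0, 0}} {M : Type w} [L.Structure M]

/-- A formula true of the elements of `M` themselves remains true of other elements, one of which
may be prescribed within its type. -/
theorem exists_realize_of_same_type {a b : M}
    (hab : ∀ φ : L.Formula (Fin 1), φ.Realize (fun _ => a) ↔ φ.Realize (fun _ => b))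
    (φ : L.Formula M) (hφ : φ.Realize id) : ∃ h : M → M, h a = b ∧ φ.Realize h := by
  classical
  let ι : φ.freeVarFinset → Fin 1 ⊕ φ.freeVarFinset := fun v =>
    if (v : M) = a then .inl 0 else .inr v
  -- The element `a` becomes the free variable and all other elements occurring in `φ` are
  -- quantified away; witnesses for `ψ` at `b` give the new assignment.
  let ψ : L.Formula (Fin 1) :=
    Formula.iExs φ.freeVarFinset (BoundedFormula.restrictFreeVar φ ι : L.Formula _)
  have h1 : ψ.Realize fun _ => a := by
    refine Formula.realize_iExs.2 ⟨fun v => v, ?_⟩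
    refine (BoundedFormula.realize_restrictFreeVar id fun v => ?_).2 hφ
    by_cases hv : (v : M) = a
    · simp [ι, hv]
    · simp [ι, hv]
  obtain ⟨e, he⟩ := Formula.realize_iExs.1 ((hab ψ).1 h1)
  refine ⟨fun v => if v = a then b else if hv : v ∈ φ.freeVarFinset then e ⟨v, hv⟩ else b,
    if_pos rfl, (BoundedFormula.realize_restrictFreeVar _ fun v => ?_).1 he⟩
  by_cases hv : (v : M) = a
  · simp [ι, hv]
  · simp [ι, hv]

/-- Elements of the same type are identified by two elementary embeddings into a common
structure. -/
theorem exists_elementaryEmbedding_pair [Nonempty M] {a b : M}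
    (hab : ∀ φ : L.Formula (Fin 1), φ.Realize (fun _ => a) ↔ φ.Realize (fun _ => b)) :
    ∃ (N : Type w) (_ : L.Structure N) (i g : M ↪ₑ[L] N), g a = i b := by
  classical
  -- The index set consists of the finite parts of the elementary diagram of `M`. In the ultrapower,
  -- `i` is the diagonal map, while `g` collects the reassignments `h s`, each sending `a` to `b`.
  let I := Finset {φ : L.Formula M // φ.Realize id}
  have hS : ∀ s : I, ∃ h : M → M, h a = b ∧ ∀ φ ∈ s, φ.1.Realize h := fun s => by
    obtain ⟨h, h1, h2⟩ := exists_realize_of_same_type hab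
      (Formula.iInf fun φ : s => φ.1.1) (Formula.realize_iInf.2 fun φ => φ.1.2)
    exact ⟨h, h1, fun φ hφ => Formula.realize_iInf.1 h2 ⟨φ, hφ⟩⟩
  choose h hha hh using hS
  let U : Ultrafilter I := Ultrafilter.of atTop
  have hU : ∀ φ : L.Formula M, φ.Realize id → ∀ᶠ s in (U : Filter I), φ.Realize (h s) :=
    fun φ hφ => Ultrafilter.of_le atTop ((eventually_ge_atTop {⟨φ, hφ⟩}).mono fun s hs =>
      hh s ⟨φ, hφ⟩ (hs (Finset.mem_singleton_self _)))
  let c : (I → M) → (U : Filter I).Product fun _ => M := fun x => x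
  let i : M ↪ₑ[L] (U : Filter I).Product fun _ => M :=
    { toFun := fun m => c fun _ => m
      map_formula' := fun n φ x =>
        (Ultraproduct.realize_formula_cast (u := U) φ fun j _ => x j).trans (by simp) }
  let g : M ↪ₑ[L] (U : Filter I).Product fun _ => M :=
    { toFun := fun m => c fun s => h s m
      map_formula' := fun n φ x => by
        refine (Ultraproduct.realize_formula_cast (u := U) φ fun j s => h s (x j)).trans ?_
        have key : ∀ φ : L.Formula (Fin n), φ.Realize x →
            ∀ᶠ s in (U : Filter I), φ.Realize fun j => h s (x j) := fun φ hφ =>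
          (hU (φ.relabel x) (Formula.realize_relabel.2 hφ)).mono fun s hs =>
            Formula.realize_relabel.1 hs
        refine ⟨fun hs => ?_, key φ⟩
        by_contra hn
        obtain ⟨s, h1, h2⟩ := (hs.and (key φ.not (Formula.realize_not.2 hn))).exists
        exact Formula.realize_not.1 h2 h1 }
  refine ⟨_, inferInstance, i, g, ?_⟩
  change (c fun s => h s a) = c fun _ => b
  simp only [hha]

end FirstOrder.Language

/-! ### Consequences of infinitely many blocks -/

namespace OrdAut

namespace AutOrder

/-- The term `σ^m(x)`. -/
def iterTerm {α : Type} (m : ℕ) (x : α) : lang.Term α := (sigmaSymb.apply₁)^[m] (tm x)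

theorem realize_iterTerm {M : Type*} [lang.Structure M] [AutOrder M] {α : Type} {m : ℕ} {x : α}
    {v : α → M} : (iterTerm m x).realize v = iter m (v x) := by
  induction m with
  | zero => simp [iterTerm, tm]
  | succ m ih =>
    rw [iterTerm, Function.iterate_succ_apply', Term.realize_functions_apply₁, funMap_sigma,
      Nat.cast_succ, add_comm, iter_add, iter_one, ← ih]
    rfl

variable {M : Type w} [lang.Structure M] [AutOrder M]

/-- Two inequivalent points cannot span an interval of constant points only. Using disjoint
consecutive pairs keeps the points found in distinct classes. -/
theorem IsChain.exists_typ_ne_const {k : ℕ} {y : Fin (2 * k) → M} (hy : IsChain y) :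
    ∃ z : Fin k → M, IsChain z ∧ ∀ i, typ (z i) ≠ .const := by
  have : ∀ i : Fin k, ∃ z, y ⟨2 * i, by omega⟩ ≤ z ∧ z ≤ y ⟨2 * i + 1, by omega⟩ ∧
      typ z ≠ .const := by
    intro i
    obtain ⟨h1, h2⟩ := hy ⟨2 * i, by omega⟩ ⟨2 * i + 1, by omega⟩ (by simp [Fin.lt_def])
    by_contra! h
    refine h2 fun e he => ?_
    rw [Set.uIcc_of_le h1.le] at he
    rw [h e he.1 he.2, h _ le_rfl h1.le]
  choose z hz1 hz2 hz3 using this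
  refine ⟨z, fun i j hij => ?_, hz3⟩
  rw [Fin.lt_def] at hij
  obtain ⟨h1, h2⟩ := hy ⟨2 * i + 1, by omega⟩ ⟨2 * j, by omega⟩
    (by rw [Fin.lt_def]; simp only; omega)
  exact ⟨(hz2 i).trans_lt (h1.trans_le (hz1 j)), fun h => h2
    ((h.left_of_le_of_le (hz2 i) (h1.le.trans (hz1 j))).symm.trans
      (h.left_of_le_of_le ((hz2 i).trans h1.le) (hz1 j)))⟩

theorem exists_agree_of_infinite_blocks (h : ∀ k, ∃ y : Fin k → M, IsChain y)
    (s : Finset (lang.Formula (Fin 1))) : ∃ a b : M,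
      (∀ φ ∈ s, φ.Realize (fun _ => a) ↔ φ.Realize (fun _ => b)) ∧
      a < b ∧ ¬ Approx a b ∧ typ a ≠ .const := by
  classical
  -- This yields one more nonconstant point than there are truth assignments on `s`, so two of the
  -- points agree on `s`.
  obtain ⟨y, hy⟩ := h (2 * (Fintype.card (s → Prop) + 1))
  obtain ⟨z, hz, hzt⟩ := hy.exists_typ_ne_const
  obtain ⟨i, j, hij, he⟩ := Fintype.exists_ne_map_eq_of_card_lt
    (fun i (φ : s) => φ.1.Realize fun _ => z i) (by simp)
  rcases lt_or_gt_of_ne hij with hij | hij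
  · exact ⟨z i, z j, fun φ hφ => (congrFun he ⟨φ, hφ⟩).to_iff, (hz i j hij).1, (hz i j hij).2,
      hzt i⟩
  · exact ⟨z j, z i, fun φ hφ => (congrFun he ⟨φ, hφ⟩).symm.to_iff, (hz j i hij).1,
      (hz j i hij).2, hzt j⟩

/-- Finite approximation to a point of the same block above the whole orbit. Terms contain only
nonnegative powers of `σ`, so negative exponents are expressed by `a < σ^m(y)`. -/
theorem exists_beyond_iterates {a : M} (ha : typ a ≠ .const) (k : ℕ) : ∃ y, Approx a y ∧
    ∀ m : ℕ, m ≤ k → iter m a < y ∧ a < iter m y := by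
  cases h : typ a with
  | const => exact absurd h ha
  | inc =>
    have hm := strictMono_iter h
    refine ⟨iter (k + 1) a, approx_iter _ _, fun m hmk => ⟨hm (by omega), ?_⟩⟩
    rw [← iter_add]
    simpa using hm (show (0 : ℤ) < m + (k + 1) by omega)
  | dec =>
    have hm := strictAnti_iter h
    refine ⟨iter (-(k + 1 : ℤ)) a, approx_iter _ _, fun m hmk => ⟨hm (by omega), ?_⟩⟩
    rw [← iter_add]
    simpa using hm (show (m : ℤ) + -(k + 1) < 0 by omega)

-- In the ultrapower over pairs of a finite set of formulas and a bound on exponents, the finite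
-- approximations become exact by Łoś's theorem.
open Filter in
theorem exists_model_of_infinite_blocks [Nonempty M] (h : ∀ k, ∃ y : Fin k → M, IsChain y) :
    ∃ (N : Type w) (_ : lang.Structure N) (_ : AutOrder N), (∀ φ : lang.Sentence, M ⊨ φ → N ⊨ φ) ∧
      ∃ a b y : N, (∀ φ : lang.Formula (Fin 1), φ.Realize (fun _ => a) ↔ φ.Realize (fun _ => b)) ∧
        a < b ∧ ¬ Approx a b ∧ Approx a y ∧ ∀ m : ℤ, iter m a < y := by
  classical
  let I := Finset (lang.Formula (Fin 1)) × ℕ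
  choose a b hab hlt hn ht using fun s : I => exists_agree_of_infinite_blocks h s.1
  choose y hy hym using fun s : I => exists_beyond_iterates (ht s) s.2
  let U : Ultrafilter I := Ultrafilter.of atTop
  have hge : ∀ s : I, ∀ᶠ t in (U : Filter I), s ≤ t := fun s =>
    Ultrafilter.of_le atTop (eventually_ge_atTop s)
  let N := (U : Filter I).Product fun _ => M
  let c : (I → M) → N := fun x => (x : (U : Filter I).Product fun _ => M)
  have hsent : ∀ φ : lang.Sentence, M ⊨ φ → N ⊨ φ := fun φ hφ =>
    (Ultraproduct.sentence_realize φ).2 (Eventually.of_forall fun _ => hφ)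
  have hdlo : N ⊨ dloSigma := Theory.model_iff _ |>.2 fun φ hφ =>
    hsent φ ((Theory.model_iff _).1 (models_dloSigma M) φ hφ)
  obtain ⟨hN⟩ := nonempty_autOrder N
  let v : Fin 3 → ∀ s : I, M := ![a, b, y]
  have los : ∀ φ : lang.Formula (Fin 3),
      (φ.Realize fun j => c (v j)) ↔ ∀ᶠ s in (U : Filter I),
        φ.Realize fun j => v j s := fun φ => Ultraproduct.realize_formula_cast φ v
  have hR : ∀ φ : lang.Formula (Fin 3), (∀ᶠ s in (U : Filter I), φ.Realize fun j => v j s) →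
      φ.Realize fun j => c (v j) := fun φ => (los φ).2
  have h1 : ∀ m : ℕ, iter m (c a) < c y := fun m => by
    have := hR (ltT (iterTerm m 0) (tm 2)) ((hge (∅, m)).mono fun s hs => by
      rw [realize_ltT, lt_iff, realize_iterTerm]
      exact (hym s m hs.2).1)
    rwa [realize_ltT, lt_iff, realize_iterTerm] at this
  have h2 : ∀ m : ℕ, c a < iter m (c y) := fun m => by
    have := hR (ltT (tm 0) (iterTerm m 2)) ((hge (∅, m)).mono fun s hs => by
      rw [realize_ltT, lt_iff, realize_iterTerm]
      exact (hym s m hs.2).2)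
    rwa [realize_ltT, lt_iff, realize_iterTerm] at this
  refine ⟨N, inferInstance, hN, hsent, c a, c b, c y,
    fun φ => ?_, ?_, ?_, ?_, fun m => ?_⟩
  · rw [show (φ.Realize fun _ => c a) ↔ _ from
        Ultraproduct.realize_formula_cast φ fun _ => a,
      show (φ.Realize fun _ => c b) ↔ _ from
        Ultraproduct.realize_formula_cast φ fun _ => b]
    exact eventually_congr ((hge ({φ}, 0)).mono fun s hs =>
      hab s φ (hs.1 (Finset.mem_singleton_self φ)))
  · exact (lt_iff _ _).1 (realize_lt.1
      (hR (lt 0 1) (Eventually.of_forall fun s => realize_lt.2 ((lt_iff _ _).2 (hlt s)))))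
  · have := hR (approx 0 1).not
      (Eventually.of_forall fun s => Formula.realize_not.2 (mt realize_approx.1 (hn s)))
    rwa [Formula.realize_not, realize_approx] at this
  · exact realize_approx.1
      (hR (approx 0 2) (Eventually.of_forall fun s => realize_approx.2 (hy s)))
  · rcases le_total 0 m with hm | hm
    · lift m to ℕ using hm
      exact h1 m
    · obtain ⟨k, rfl⟩ := Int.exists_eq_neg_ofNat hm
      rw [← lt_iter_iff]
      exact h2 k

/-- Two elements of the same type in distinct blocks are separated by an embedding that does not
preserve the blocks. -/
theorem exists_embedding_not_approx [Nonempty M] {a b y : M}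
    (hab : ∀ φ : lang.Formula (Fin 1), φ.Realize (fun _ => a) ↔ φ.Realize (fun _ => b))
    (hlt : a < b) (hn : ¬ Approx a b) (hy : Approx a y) (hay : ∀ m : ℤ, iter m a < y) :
    ∃ (N : Type w) (_ : lang.Structure N) (_ : AutOrder N), (∀ φ : lang.Sentence, M ⊨ φ → N ⊨ φ) ∧
      ∃ f : M ↪[lang] N, ¬ Approx (f a) (f y) := by
  classical
  obtain ⟨N, _, i, g, hgi⟩ := exists_elementaryEmbedding_pair hab
  have hsent : ∀ φ : lang.Sentence, M ⊨ φ → N ⊨ φ := fun φ => (i.map_sentence φ).1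
  have : N ⊨ dloSigma := Theory.model_iff _ |>.2 fun φ hφ =>
    hsent φ ((Theory.model_iff _).1 (models_dloSigma M) φ hφ)
  obtain ⟨hN⟩ := nonempty_autOrder N
  have happ : ∀ (e : M ↪ₑ[lang] N) (u v : M), Approx (e u) (e v) ↔ Approx u v := fun e u v => by
    have := e.map_formula (approx 0 1 : lang.Formula (Fin 2)) ![u, v]
    rwa [realize_approx, realize_approx] at this
  have hmlt : ∀ (e : M ↪ₑ[lang] N) {u v : M}, e u < e v ↔ u < v := fun e =>
    map_lt_iff e.toEmbedding
  have hmit : ∀ (e : M ↪ₑ[lang] N) (m : ℤ) (u : M), e (iter m u) = iter m (e u) := fun e =>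
    map_iter e.toEmbedding
  -- A `σ`-invariant initial segment containing `a` but not `y`; this is where the two embeddings
  -- are glued.
  let low : M → Prop := fun x => ∃ m : ℤ, x ≤ iter m a
  have low_sigma : ∀ x, low (sigma x) ↔ low x := fun x => by
    constructor
    · rintro ⟨m, hm⟩
      refine ⟨m - 1, (iter 1).le_iff_le.1 ?_⟩
      rwa [iter_one, ← iter_add, add_sub_cancel]
    · rintro ⟨m, hm⟩
      refine ⟨1 + m, ?_⟩
      rw [iter_add, iter_one]
      exact sigma.le_iff_le.2 hm
  let f : M ↪[lang] N := embeddingOfStrictMono (fun x => if low x then i x else g x)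
    (fun x x' hx => by
      by_cases h1 : low x <;> by_cases h2 : low x'
      · simpa [h1, h2, hmlt] using hx
      · simp only [h1, h2, if_true, if_false]
        obtain ⟨m, hm⟩ := h1
        have h3 : iter m a < x' := by
          by_contra! h3
          exact h2 ⟨m, h3⟩
        -- Order is preserved across the seam because `g` carries the orbit of `a` to the orbit of
        -- `i b`, which lies termwise above the orbit of `i a`.
        calc i x ≤ i (iter m a) := le_of_not_gt fun h => hm.not_gt ((hmlt i).1 h)
          _ = iter m (i a) := hmit _ _ _
          _ < iter m (i b) := (iter m).lt_iff_lt.2 ((hmlt i).2 hlt)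
          _ = g (iter m a) := by rw [← hgi, hmit]
          _ < g x' := (hmlt g).2 h3
      · obtain ⟨m, hm⟩ := h2
        exact absurd ⟨m, hx.le.trans hm⟩ h1
      · simpa [h1, h2, hmlt] using hx)
    (fun x => by
      by_cases h1 : low x
      · simpa [low_sigma, h1] using map_sigma i.toEmbedding x
      · simpa [low_sigma, h1] using map_sigma g.toEmbedding x)
  refine ⟨N, inferInstance, hN, hsent, f, fun h => hn ?_⟩
  have hfa : f a = i a := if_pos ⟨0, by simp⟩
  have hfy : f y = g y := if_neg fun ⟨m, hm⟩ => hm.not_gt (hay m)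
  rw [hfa, hfy] at h
  rw [← happ i, ← hgi]
  exact h.trans ((happ g _ _).2 hy).symm

end AutOrder

open AutOrder

/-! ### Models of model complete extensions -/

theorem Extends.models {T T₀ : lang.Theory} (h : T.Extends T₀) (M : Type*) [lang.Structure M]
    [Nonempty M] [M ⊨ T] : M ⊨ T₀ :=
  (Theory.model_iff _).2 fun φ hφ => (h φ hφ).realize_sentence M

section

variable {T : lang.Theory} (hT : Theory.IsModelComplete.{w} T) {M : Type w} [lang.Structure M]
  [AutOrder M] [Nonempty M] [M ⊨ T]

include hT

theorem exists_not_isChain : ∃ k, ¬ ∃ y : Fin k → M, IsChain y := by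
  by_contra! h
  obtain ⟨N, _, _, hN, a, b, y, hab, hlt, hn, hy, hay⟩ := exists_model_of_infinite_blocks h
  have : Nonempty N := ⟨a⟩
  obtain ⟨P, _, _, hP, f, hf⟩ := exists_embedding_not_approx hab hlt hn hy hay
  have : Nonempty P := ⟨f a⟩
  have : N ⊨ T := (Theory.model_iff _).2 fun φ hφ =>
    hN φ ((Theory.model_iff _).1 ‹M ⊨ T› φ hφ)
  have : P ⊨ T := (Theory.model_iff _).2 fun φ hφ =>
    hP φ ((Theory.model_iff _).1 ‹N ⊨ T› φ hφ)
  have := hT N P f 2 (approx 0 1) ![a, y]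
  rw [realize_approx, realize_approx] at this
  exact hf (this.2 hy)

/-- The block of `a` is a countable order, so it embeds into the dense interval `(l, r)`, which is
contained in it. As `σ` fixes the block pointwise, extending by the identity gives a self-embedding
of `M`, elementary by model completeness. -/
theorem realize_of_mem_Ioo [Countable M] {a l r : M} (ha : typ a = .const) (hl : Approx a l)
    (hr : Approx a r) (hlr : l < r) :
    ∃ a' ∈ Set.Ioo l r, ∀ φ : lang.Formula (Fin 1),
      φ.Realize (fun _ => a') ↔ φ.Realize (fun _ => a) := by
  classical
  have hIoo : ∀ {z}, z ∈ Set.Ioo l r → Approx a z := fun hz =>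
    hl.trans ((hl.symm.trans hr).left_of_le_of_le hz.1.le hz.2.le)
  have : Nontrivial (Set.Ioo l r) := by
    obtain ⟨u, hu⟩ := exists_between hlr
    obtain ⟨v, hv⟩ := exists_between hu.2
    exact ⟨⟨u, hu⟩, ⟨v, hu.1.trans hv.1, hv.2⟩, fun h => hv.1.ne (congrArg Subtype.val h)⟩
  obtain ⟨e⟩ := Order.embedding_from_countable_to_dense {x : M // Approx a x} (Set.Ioo l r)
  have hfix : ∀ {z : M}, Approx a z → sigma z = z := fun hz =>
    typ_eq_const.1 (hz.typ_eq.trans ha)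
  let f : M ↪[lang] M := embeddingOfStrictMono
    (fun x => if h : Approx a x then (e ⟨x, h⟩ : M) else x)
    (fun x x' hx => by
      by_cases h1 : Approx a x <;> by_cases h2 : Approx a x'
      · simp only [h1, h2, dif_pos]
        exact e.lt_iff_lt.2 (show (⟨x, h1⟩ : {x : M // Approx a x}) < ⟨x', h2⟩ from hx)
      · simp only [h1, h2, dif_pos, dif_neg, not_false_eq_true]
        exact lt_of_approx hx (fun h => h2 (h1.trans h)) (h1.symm.trans (hIoo (e ⟨x, h1⟩).2))
          (.refl _)
      · simp only [h1, h2, dif_pos, dif_neg, not_false_eq_true]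
        exact lt_of_approx hx (fun h => h1 (h2.trans h.symm)) (.refl _)
          (h2.symm.trans (hIoo (e ⟨x', h2⟩).2))
      · simpa [h1, h2] using hx)
    (fun x => by
      by_cases h1 : Approx a x
      · simp only [hfix h1, h1, dif_pos]
        exact (hfix (hIoo (e ⟨x, h1⟩).2)).symm
      · have h2 : ¬ Approx a (sigma x) := fun h => h1 (h.trans (approx_sigma x).symm)
        simp only [h1, h2, dif_neg, not_false_eq_true])
  refine ⟨f a, ?_, fun φ => hT M M f 1 φ fun _ => a⟩
  have : f a = e ⟨a, .refl a⟩ := dif_pos (Approx.refl a)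
  rw [this]
  exact (e _).2

/-- Being the greatest element of one's block is definable, but a greatest `a` would share its type
with a smaller point of the block. -/
theorem exists_approx_gt [Countable M] {a b : M} (ha : typ a = .const) (hb : Approx a b)
    (hne : a ≠ b) : ∃ z, Approx a z ∧ a < z := by
  by_contra! h
  have hlt : b < a := lt_of_le_of_ne (h b hb) hne.symm
  obtain ⟨a', ha', hφ⟩ := realize_of_mem_Ioo hT ha hb (.refl a) hlt
  have := (hφ (all1 (relR (.inl 0) (.inr 0)).not)).2
  simp only [realize_all1, Formula.realize_not, realize_relR, Sum.elim_inl, Sum.elim_inr] at this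
  exact this (fun z hz => (h z hz.2).not_gt hz.1) a
    ⟨ha'.2, hb.symm.right_of_le_of_le ha'.1.le ha'.2.le⟩

theorem exists_approx_lt [Countable M] {a b : M} (ha : typ a = .const) (hb : Approx a b)
    (hne : a ≠ b) : ∃ z, Approx a z ∧ z < a := by
  by_contra! h
  have hlt : a < b := lt_of_le_of_ne (h b hb) hne
  obtain ⟨a', ha', hφ⟩ := realize_of_mem_Ioo hT ha (.refl a) hb hlt
  have := (hφ (all1 (relR (.inr 0) (.inl 0)).not)).2
  simp only [realize_all1, Formula.realize_not, realize_relR, Sum.elim_inl, Sum.elim_inr] at this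
  exact this (fun z hz => (h z hz.2.symm).not_gt hz.1) a
    ⟨ha'.1, hb.left_of_le_of_le ha'.1.le ha'.2.le⟩

theorem exists_models_blockTheory [Countable M] : ∃ (n : ℕ) (p : Fin n → BlockKind),
    IsAlternationPattern p ∧ M ⊨ blockTheory p := by
  classical
  have hex := exists_not_isChain hT (M := M)
  obtain ⟨n, hn⟩ : ∃ n, Nat.find hex = n + 1 := by
    refine Nat.exists_eq_succ_of_ne_zero fun h0 => ?_
    have := Nat.find_spec hex
    rw [h0] at this
    exact this ⟨Fin.elim0, fun i => i.elim0⟩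
  obtain ⟨β, hβ⟩ := exists_isBlockIndex (n := n) (not_not.1 (Nat.find_min hex (by omega)))
    (hn ▸ Nat.find_spec hex)
  obtain ⟨g, hg⟩ : ∃ g : Fin n → M, ∀ i, β (g i) = i := hβ.surj.hasRightInverse
  -- The pattern is read off representatives; a constant block with a second point is declared
  -- `.constDLO`, to be justified by the two preceding lemmas.
  let p : Fin n → BlockKind := fun i => match typ (g i) with
    | .inc => .inc
    | .dec => .dec
    | .const => if ∃ z, β z = i ∧ z ≠ g i then .constDLO else .constSingleton
  have htyp : ∀ i x, β x = i → typ x = (p i).type := by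
    intro i x hx
    have : typ x = typ (g i) := (hβ.eq_iff.1 ((hg i).trans hx.symm)).typ_eq
    rw [this]
    cases h : typ (g i)
    · simp only [p, h]
      split_ifs <;> rfl
    · simp only [p, h, BlockKind.type]
    · simp only [p, h, BlockKind.type]
  have hsing : ∀ i, p i = .constSingleton → ∀ x, β x = i → x = g i := by
    intro i hi x hx
    cases h : typ (g i)
    · simp only [p, h] at hi
      split_ifs at hi with hz
      by_contra hne
      exact hz ⟨x, hx, hne⟩
    · simp [p, h] at hi
    · simp [p, h] at hi
  have hdlo : ∀ i, p i = .constDLO → ∀ x, β x = i → typ x = .const ∧ ∃ z, Approx x z ∧ x ≠ z := by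
    intro i hi x hx
    refine ⟨by rw [htyp i x hx, hi]; rfl, ?_⟩
    cases h : typ (g i)
    · simp only [p, h] at hi
      split_ifs at hi with hz
      obtain ⟨z, hz, hne⟩ := hz
      by_cases hxz : x = z
      · exact ⟨g i, hβ.eq_iff.1 (hx.trans (hg i).symm), hxz ▸ hne⟩
      · exact ⟨z, hβ.eq_iff.1 (hx.trans hz.symm), hxz⟩
    · simp [p, h] at hi
    · simp [p, h] at hi
  refine ⟨n, p, ⟨?_, fun i j hij he => ?_, fun i hi => ⟨?_, ?_⟩⟩,
    models_blockTheory_iff.2 ⟨β, hβ, fun i => ⟨htyp i, fun hi x y hx hy => ?_, ?_, ?_⟩⟩⟩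
  · exact Fin.pos (β (Classical.arbitrary M))
  · have hlt : g i < g j := hβ.mono.reflect_lt (by rw [hg, hg, Fin.lt_def]; omega)
    -- Adjacent blocks of equal type would form one class.
    have : Approx (g i) (g j) := fun e he' => by
      rw [Set.uIcc_of_le hlt.le] at he'
      have h1 := hβ.mono he'.1
      have h2 := hβ.mono he'.2
      rw [hg, Fin.le_def] at h1 h2
      rw [htyp i _ (hg i)]
      rcases (show (β e : ℕ) = i ∨ (β e : ℕ) = j by omega) with h | h
      · exact htyp i e (Fin.ext h)
      · rw [he]
        exact htyp j e (Fin.ext h)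
    have := hβ.eq_iff.2 this
    rw [hg, hg, Fin.ext_iff] at this
    omega
  · obtain ⟨y, hy⟩ := exists_lt (g i)
    have h1 : β y ≠ i := fun h => hy.ne (hsing i hi y h)
    have h2 := hβ.mono hy.le
    rw [hg] at h2
    have := lt_of_le_of_ne h2 h1
    rw [Fin.lt_def] at this
    omega
  · obtain ⟨y, hy⟩ := exists_gt (g i)
    have h1 : β y ≠ i := fun h => hy.ne' (hsing i hi y h)
    have h2 := hβ.mono hy.le
    rw [hg] at h2
    have := lt_of_le_of_ne h2 h1.symm
    rw [Fin.lt_def] at this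
    omega
  · rw [hsing i hi x hx, hsing i hi y hy]
  · intro hi x hx
    obtain ⟨ht, z, hz, hne⟩ := hdlo i hi x hx
    obtain ⟨y, hy, hlt⟩ := exists_approx_gt hT ht hz hne
    exact ⟨y, (hβ.eq_iff.2 hy).symm.trans hx, hlt⟩
  · intro hi x hx
    obtain ⟨ht, z, hz, hne⟩ := hdlo i hi x hx
    obtain ⟨y, hy, hlt⟩ := exists_approx_lt hT ht hz hne
    exact ⟨y, (hβ.eq_iff.2 hy).symm.trans hx, hlt⟩

end

theorem card_lang_le : lang.card ≤ Cardinal.aleph0 := by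
  have : ∀ l, Countable (lang.Functions l) := fun l =>
    (show Function.Injective fun _ : Func l => () by
      rintro ⟨⟩ ⟨⟩ _; rfl).countable
  have : ∀ l, Countable (lang.Relations l) := fun l =>
    (show Function.Injective fun _ : Rel l => () by
      rintro ⟨⟩ ⟨⟩ _; rfl).countable
  exact Cardinal.mk_le_aleph0_iff.2 (inferInstanceAs (Countable (_ ⊕ _)))

/-- Orders without a greatest element are infinite, so Löwenheim–Skolem applies; countability is
what allows constant blocks to be embedded into intervals. -/
theorem exists_countable_model {T : lang.Theory} (h : T.Extends dloSigma) (hT : T.IsSatisfiable) :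
    ∃ M : T.ModelType, Countable (M : Type w) := by
  obtain ⟨M⟩ := hT
  have := Extends.models h M
  obtain ⟨_⟩ := nonempty_autOrder M
  have : Infinite M := NoMaxOrder.infinite
  obtain ⟨N, hN⟩ := Theory.exists_model_card_eq.{0, 0, w} ⟨M, this⟩ Cardinal.aleph0 le_rfl
    (by simpa using card_lang_le)
  exact ⟨N, Cardinal.mk_le_aleph0_iff.1 hN.le⟩

theorem models_of_logicallyEquivalent {T T' : lang.Theory} (h : T.LogicallyEquivalent T')
    (M : Type*) [lang.Structure M] [Nonempty M] [M ⊨ T] : M ⊨ T' :=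
  (Theory.model_iff _).2 fun φ hφ =>
    ((h φ).2 (Theory.models_sentence_of_mem hφ)).realize_sentence M

theorem isComplete_and_isModelComplete_iff {T : lang.Theory} (hT : T.Extends dloSigma) :
    T.IsComplete ∧ Theory.IsModelComplete.{w} T ↔
      ∃ (n : ℕ) (p : Fin n → BlockKind), IsAlternationPattern p ∧
        T.LogicallyEquivalent (blockTheory p) := by
  constructor
  · rintro ⟨hc, hmc⟩
    obtain ⟨M, _⟩ := exists_countable_model.{w} hT hc.1
    have := Extends.models hT M
    obtain ⟨_⟩ := nonempty_autOrder M
    obtain ⟨n, p, hp, hM⟩ := exists_models_blockTheory hmc (M := M)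
    exact ⟨n, p, hp, fun φ => (hc.realize_sentence_iff φ M).symm.trans
      ((isComplete_blockTheory hp).realize_sentence_iff φ M)⟩
  · rintro ⟨n, p, hp, h⟩
    obtain ⟨⟨M⟩, hc⟩ := isComplete_blockTheory hp
    refine ⟨⟨?_, fun φ => ?_⟩, ?_⟩
    · have := models_of_logicallyEquivalent (fun φ => (h φ).symm) M
      exact Theory.Model.isSatisfiable M
    · rw [h, h]
      exact hc φ
    · intro M N _ _ _ _ _ _
      have := models_of_logicallyEquivalent h M
      have := models_of_logicallyEquivalent h N
      exact isModelComplete_blockTheory hp M N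

/-! ### The number of complete and model complete extensions -/

/-- The pattern of `n` blocks that are alternately increasing and decreasing. -/
def alternating (n : ℕ) (i : Fin n) : BlockKind :=
  if Even (i : ℕ) then .inc else .dec

theorem isAlternationPattern_alternating (n : ℕ) : IsAlternationPattern (alternating (n + 1)) where
  pos := n.succ_pos
  alternates i j hij := by
    by_cases h : Even (i : ℕ) <;> simp [alternating, ← hij, h, Nat.even_add_one, BlockKind.type]
  interior i hi := by
    by_cases h : Even (i : ℕ) <;> simp [alternating, h] at hi

/-- A common model has one number of blocks, recovered as the greatest length of a chain. -/
theorem eq_of_logicallyEquivalent {m n : ℕ} {p : Fin m → BlockKind} {q : Fin n → BlockKind}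
    (hp : IsAlternationPattern p) (h : (blockTheory p).LogicallyEquivalent (blockTheory q)) :
    m = n := by
  obtain ⟨⟨M⟩, -⟩ := isComplete_blockTheory hp
  have := models_of_logicallyEquivalent h M
  obtain ⟨_, β, hβ⟩ := exists_isBlockMap p M
  obtain ⟨β', hβ'⟩ := models_blockTheory_iff.1 ‹M ⊨ blockTheory q›
  exact le_antisymm (hβ'.exists_isChain_iff.1 (hβ.exists_isChain_iff.2 le_rfl))
    (hβ.exists_isChain_iff.1 (hβ'.exists_isChain_iff.2 le_rfl))

/-- The set of consequences of a theory. -/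
def deductiveClosure (T : lang.Theory) : lang.Theory := {φ | T ⊨ᵇ φ}

theorem logicallyEquivalent_deductiveClosure (T : lang.Theory) :
    T.LogicallyEquivalent (deductiveClosure T) := fun _ =>
  ⟨fun h => Theory.models_sentence_of_mem h, fun h =>
    Theory.models_of_models_theory (fun _ hψ => hψ) h⟩

theorem mk_complete_modelComplete_extensions :
    Cardinal.mk {T : lang.Theory // T.IsDeductivelyClosed ∧ T.Extends dloSigma ∧
      T.IsComplete ∧ Theory.IsModelComplete.{w} T} = Cardinal.aleph0 := by
  have hdc : ∀ {T T' : lang.Theory}, T.IsDeductivelyClosed → T'.IsDeductivelyClosed →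
      T.LogicallyEquivalent T' → T = T' := fun h h' he => Set.ext fun φ =>
    ⟨fun hφ => h' φ ((he φ).1 (Theory.models_sentence_of_mem hφ)),
      fun hφ => h φ ((he φ).2 (Theory.models_sentence_of_mem hφ))⟩
  apply le_antisymm
  · choose! n p hp he using fun T : {T : lang.Theory // T.IsDeductivelyClosed ∧
      T.Extends dloSigma ∧ T.IsComplete ∧ Theory.IsModelComplete.{w} T} =>
        (isComplete_and_isModelComplete_iff T.2.2.1).1 T.2.2.2
    have : Countable BlockKind := by
      have : Function.Surjective fun i : Fin 4 =>
          ![BlockKind.constSingleton, .constDLO, .inc, .dec] i := by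
        rintro ⟨⟩
        exacts [⟨0, rfl⟩, ⟨1, rfl⟩, ⟨2, rfl⟩, ⟨3, rfl⟩]
      exact this.countable
    -- A deductively closed theory is determined by a pattern whose theory is equivalent to it, and
    -- there are countably many patterns.
    refine Cardinal.mk_le_aleph0_iff.2 (Function.Injective.countable
      (f := fun T => (⟨n T, p T⟩ : Σ n, Fin n → BlockKind)) fun T T' h => ?_)
    refine Subtype.ext (hdc T.2.1 T'.2.1 fun φ => (he T φ).trans ?_)
    have key : ∀ s t : Σ n, Fin n → BlockKind, s = t →
        (blockTheory s.2 ⊨ᵇ φ ↔ blockTheory t.2 ⊨ᵇ φ) := by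
      rintro s _ rfl
      rfl
    exact (key _ _ h).trans (he T' φ).symm
  · have ext : ∀ n, (deductiveClosure (blockTheory (alternating (n + 1)))).Extends dloSigma :=
      fun n φ hφ => Theory.models_sentence_of_mem
        (Theory.models_sentence_of_mem (dloSigma_subset_blockTheory hφ))
    refine Cardinal.aleph0_le_mk_iff.2 (Infinite.of_injective
      (fun n : ℕ => ⟨deductiveClosure (blockTheory (alternating (n + 1))),
        fun φ hφ => (logicallyEquivalent_deductiveClosure _ φ).2 hφ, ext n,
        (isComplete_and_isModelComplete_iff (ext n)).2 ⟨_, _, isAlternationPattern_alternating n,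
          fun φ => (logicallyEquivalent_deductiveClosure _ φ).symm⟩⟩) fun m n h => ?_)
    refine Nat.succ_injective (eq_of_logicallyEquivalent (isAlternationPattern_alternating m)
      (q := alternating (n + 1)) fun φ => ?_)
    exact Set.ext_iff.1 (congrArg Subtype.val h) φ

end OrdAut

theorem theorem2p11 :
    -- the theories given by alternation patterns are complete, model complete, weakly o-minimal
    (∀ (n : ℕ) (p : Fin n → OrdAut.BlockKind), OrdAut.IsAlternationPattern p →
      (OrdAut.blockTheory p).IsComplete ∧
      FirstOrder.Language.Theory.IsModelComplete.{w} (OrdAut.blockTheory p) ∧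
      OrdAut.IsWeaklyOMinimal.{w} (OrdAut.blockTheory p)) ∧
    -- up to logical equivalence they are all the complete and model complete extensions
    (∀ T : OrdAut.lang.Theory, T.Extends OrdAut.dloSigma →
      (T.IsComplete ∧ FirstOrder.Language.Theory.IsModelComplete.{w} T ↔
        ∃ (n : ℕ) (p : Fin n → OrdAut.BlockKind), OrdAut.IsAlternationPattern p ∧
          T.LogicallyEquivalent (OrdAut.blockTheory p))) ∧
    -- there are exactly `ℵ₀` such theories
    Cardinal.mk {T : OrdAut.lang.Theory // T.IsDeductivelyClosed ∧ T.Extends OrdAut.dloSigma ∧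
      T.IsComplete ∧ FirstOrder.Language.Theory.IsModelComplete.{w} T} = Cardinal.aleph0 :=
  ⟨fun _ _ hp => ⟨OrdAut.isComplete_blockTheory hp, OrdAut.isModelComplete_blockTheory hp,
      OrdAut.isWeaklyOMinimal_blockTheory⟩,
    fun _ hT => OrdAut.isComplete_and_isModelComplete_iff hT,
    OrdAut.mk_complete_modelComplete_extensions⟩
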